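/- All graphs are simple and undirected, and labels are nonnegative real numbers. In a tree with root $r$, a vertex $v$ is a direct successor of a vertex $u$ if $u$ and $v$ are adjacent and $u$ lies on the path from $v$ to $r$; $\mathrm{Ch}(u)$ denotes the set of direct successors of $u$, and $\delta^{+}(u)=|\mathrm{Ch}(u)|$. A leaf is a vertex of degree less than two; the other vertices are internal. An isomorphism of labeled rooted trees is a graph isomorphism that preserves the root and the labels. Let $(X,d)$ be a finite nonempty ultrametric space. Its representing tree $T_X$ is the labeled rooted tree whose vertices are subsets of $X$, built as follows. The root is $X$, and the label of a vertex $A$ is $\operatorname{diam} A$. A vertex $A$ with $|A|=1$ has no direct successors. If $|A|\ge 2$, then the graph on $A$ in which $x,y$ are adjacent if and only if $d(x,y)=\operatorname{diam}A$ is complete multipartite, and the direct successors of $A$ are its parts. The ballean $\mathbf{B}_X$ is the set of all closed balls $\{x : d(x,c)\le \rho\}$, $c\in X$, $\rho\ge 0$, equipped with the Hausdorff distance; it is again a finite nonempty ultrametric space. Put $\mathbf{B}_X^{(0)}=X$ and let $\mathbf{B}_X^{(n)}$ be the ballean of $\mathbf{B}_X^{(n-1)}$ for $n\ge 1$. **Theorem.**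 Let $T$ be a finite labeled rooted tree with labeling $l\colon V(T)\to[0,\infty)$ and let $n\ge 0$ be an integer. Then $T$ is isomorphic, as a labeled rooted tree, to the representing tree of $\mathbf{B}_X^{(n)}$ for some finite nonempty ultrametric space $(X,d)$ if and only if the following conditions hold: 1. for every $u\in V(T)$ we have $\delta^{+}(u)\notin\{1,\ldots,n+1\}$, and $\delta^{+}(u)=0$ if and only if $l(u)=0$; 2. $l(v)<l(u)$ whenever $v$ is a direct successor of $u$; 3. for every internal vertex $u$ of $T$, at least $n$ elements of $\mathrm{Ch}(u)$ are leaves of $T$. -/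

import Mathlib

open scoped NNReal

universe u v w

/-! ## Labeled rooted graphs and trees -/

/-- A graph on the vertex set `V` with a distinguished vertex (the root) and a labeling
`V → [0, ∞)`. It is a labeled rooted tree when its underlying graph is a tree. -/
structure LabeledRootedGraph (V : Type u) where
  /-- the underlying graph -/
  graph : SimpleGraph V
  /-- the root -/
  root : V
  /-- the labeling -/
  label : V → ℝ≥0

namespace LabeledRootedGraph

variable {V : Type u} {W : Type w}

/-- The underlying graph is a tree (connected and without cycles). -/
def IsTree (T : LabeledRootedGraph V) : Prop :=
  T.graph.IsTree

/-- `u` is a predecessor of `v` (and `v` is a successor of `u`): `u ≠ v`, and `u` lies on the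
path (unique if the graph is a tree) joining `v` and the root. -/
def IsPredecessor (T : LabeledRootedGraph V) (u v : V) : Prop :=
  u ≠ v ∧ ∃ p : T.graph.Walk v T.root, p.IsPath ∧ u ∈ p.support

/-- The set `Ch(u)` of all direct successors of `u`. -/
def directSuccessors (T : LabeledRootedGraph V) (u : V) : Set V :=
  {v | T.graph.Adj u v ∧ T.IsPredecessor u v}

/-- The out-degree `δ⁺(u)`: the number of direct successors of `u`. -/
noncomputable def outDegree (T : LabeledRootedGraph V) (u : V) : ℕ :=
  (T.directSuccessors u).ncard

/-- The set of leaves: the vertices of degree less than two. The other vertices are called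
internal. -/
def leaves (T : LabeledRootedGraph V) : Set V :=
  {v | (T.graph.neighborSet v).ncard < 2}

/-- Isomorphism of labeled rooted graphs: a graph isomorphism that preserves the root and the
labels. -/
def Isomorphic (T₁ : LabeledRootedGraph V) (T₂ : LabeledRootedGraph W) : Prop :=
  ∃ f : T₁.graph ≃g T₂.graph, f T₁.root = T₂.root ∧ ∀ x, T₂.label (f x) = T₁.label x

end LabeledRootedGraph

/-! ## The representing tree -/

section RepresentingTree

variable {X : Type u} [MetricSpace X]

/-- The diametrical graph of the subspace `A`: its vertices are the points of `A`, and two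
different points are adjacent if and only if their distance is the diameter of `A`. -/
def diametricalGraph (A : Set X) : SimpleGraph A where
  Adj x y := x ≠ y ∧ dist x y = Metric.diam A
  symm := ⟨fun x y h => ⟨h.1.symm, by rw [dist_comm]; exact h.2⟩⟩
  loopless := ⟨fun _ h => h.1 rfl⟩

/-- The parts of the diametrical graph of `A`, as subsets of `X`. In a complete multipartite
graph the part that contains a vertex `x` consists of the vertices not adjacent to `x`. -/
def diametricalParts (A : Set X) : Set (Set X) :=
  {B | ∃ x : A, B = Subtype.val '' {y : A | ¬ (diametricalGraph A).Adj x y}}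

/-- `B` is a vertex of the level just below the vertex `A`: the set `A` has at least two points
and `B` is a part of its diametrical graph. -/
def IsNextLevel (A B : Set X) : Prop :=
  A.Nontrivial ∧ B ∈ diametricalParts A

variable (X) in
/-- The vertices of the representing tree: the whole space, and then, level by level, the parts
of the diametrical graphs of the vertices with at least two points. -/
inductive IsRepresentingVertex : Set X → Prop
  | root : IsRepresentingVertex Set.univ
  | next {A B : Set X} (hA : IsRepresentingVertex A) (hB : IsNextLevel A B) :
      IsRepresentingVertex B

variable (X) in
/-- The representing tree `T_X` of a finite nonempty ultrametric space: the root is `X`, the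
label of a vertex is its diameter, and the edges join a vertex to the parts of its diametrical
graph. -/
noncomputable def representingTree :
    LabeledRootedGraph {A : Set X // IsRepresentingVertex X A} where
  graph := SimpleGraph.fromRel fun A B => IsNextLevel A.1 B.1
  root := ⟨Set.univ, .root⟩
  label A := ⟨Metric.diam A.1, Metric.diam_nonneg⟩

end RepresentingTree

/-! ## Iterated balleans -/

/-- The ballean of a metric space: the type of all its closed balls. -/
def Ballean (X : Type u) [MetricSpace X] : Type u :=
  {B : Set X // ∃ (c : X) (r : ℝ), 0 ≤ r ∧ B = Metric.closedBall c r}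

namespace Ballean

variable {X : Type u} [MetricSpace X]

theorem nonempty_val (B : Ballean X) : B.1.Nonempty := by
  obtain ⟨c, r, hr, h⟩ := B.2
  rw [h]
  exact ⟨c, Metric.mem_closedBall_self hr⟩

theorem hausdorffEDist_ne_top (B C : Ballean X) : Metric.hausdorffEDist B.1 C.1 ≠ ⊤ := by
  obtain ⟨b, r, hr, h⟩ := id B.2
  obtain ⟨c, s, hs, h'⟩ := id C.2
  refine Metric.hausdorffEDist_ne_top_of_nonempty_of_bounded B.nonempty_val C.nonempty_val ?_ ?_
  · rw [h]; exact Metric.isBounded_closedBall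
  · rw [h']; exact Metric.isBounded_closedBall

theorem isClosed_val (B : Ballean X) : IsClosed B.1 := by
  obtain ⟨c, r, hr, h⟩ := B.2
  rw [h]
  exact Metric.isClosed_closedBall

/-- The ballean with the Hausdorff distance. -/
noncomputable instance : MetricSpace (Ballean X) where
  dist B C := Metric.hausdorffDist B.1 C.1
  dist_self _ := Metric.hausdorffDist_self_zero
  dist_comm _ _ := Metric.hausdorffDist_comm
  dist_triangle B C _ := Metric.hausdorffDist_triangle (hausdorffEDist_ne_top B C)
  eq_of_dist_eq_zero {B C} h := Subtype.ext
    ((B.isClosed_val.hausdorffDist_zero_iff_eq C.isClosed_val (hausdorffEDist_ne_top B C)).1 h)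

instance [Finite X] : Finite (Ballean X) :=
  inferInstanceAs (Finite {_B : Set X // _})

instance [Nonempty X] : Nonempty (Ballean X) :=
  ⟨⟨Metric.closedBall (Classical.arbitrary X) 0, _, 0, le_rfl, rfl⟩⟩

instance [IsUltrametricDist X] : IsUltrametricDist (Ballean X) where
  dist_triangle_max A B C := by
    refine le_of_forall_gt_imp_ge_of_dense fun r hr => ?_
    obtain ⟨h1, h2⟩ := max_lt_iff.1 hr
    have key : ∀ {P Q R : Ballean X}, dist P Q < r → dist Q R < r →
        ∀ x ∈ P.1, ∃ y ∈ R.1, dist x y ≤ r := by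
      intro P Q R hPQ hQR x hx
      obtain ⟨y, hy, hxy⟩ :=
        Metric.exists_dist_lt_of_hausdorffDist_lt hx hPQ (hausdorffEDist_ne_top P Q)
      obtain ⟨z, hz, hyz⟩ :=
        Metric.exists_dist_lt_of_hausdorffDist_lt hy hQR (hausdorffEDist_ne_top Q R)
      exact ⟨z, hz, (dist_triangle_max x y z).trans (max_le hxy.le hyz.le)⟩
    refine Metric.hausdorffDist_le_of_mem_dist (dist_nonneg.trans h1.le) (key h1 h2) ?_
    exact key (by rwa [dist_comm]) (by rwa [dist_comm])

end Ballean

/-- A finite nonempty ultrametric space. -/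
structure FinUltrametricSpace : Type (u + 1) where
  /-- the set of points -/
  carrier : Type u
  [metricSpace : MetricSpace carrier]
  [isUltrametricDist : IsUltrametricDist carrier]
  [finite : Finite carrier]
  [nonempty : Nonempty carrier]

namespace FinUltrametricSpace

attribute [instance] metricSpace isUltrametricDist finite nonempty

/-- The ballean of a finite nonempty ultrametric space, with the Hausdorff distance. -/
noncomputable def ballean (X : FinUltrametricSpace.{u}) : FinUltrametricSpace.{u} :=
  ⟨Ballean X.carrier⟩

/-- The `n`-th iterated ballean: the space itself for `n = 0`, and the ballean of the previous
space, with the Hausdorff distance, at each further step. -/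
noncomputable def iteratedBallean (X : FinUltrametricSpace.{u}) : ℕ → FinUltrametricSpace.{u}
  | 0 => X
  | n + 1 => (iteratedBallean X n).ballean

end FinUltrametricSpace

/-! For a representing tree, the conditions on out-degrees and leaves amount to a metric condition
on the space, `IsIteratedBalleanSpace`: in every ball that is not a point, `n + 2` points at
pairwise distance equal to the diameter come from `n + 2` different parts, and `n` points at that
distance from all the others come from `n` one-point parts.

Passing to the ballean raises `n` by one (`IsIteratedBalleanSpace.ballean`). The one-point balls
form a copy of the old space, and in each nontrivial ball of the ballean the largest member, itself
a ball of the old space, is a new point at full distance from all the others.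

Conversely, let `Y` satisfy the condition for `n + 1`. Select in each ball `A` one isolated point `p
A`, and delete from `Y` the points selected in balls with at least two points. The remaining
subspace satisfies the condition for `n`, and its ballean is isometric to `Y`
(`IsIsolatedSelection.isometry_hull`, `IsIsolatedSelection.surjective_hull`): a kept point stands
for its one-point ball, a deleted point for the ball in which it was selected. Iteration produces
the required `X`.

It remains to realise the tree. A tree satisfying the conditions is the representing tree of the set
of its vertices without direct successors, two of them being as far apart as the least label of a
common ancestor (`isomorphic_representingTree_ends`). -/

namespace LabeledRootedGraph

variable {V : Type u} {W : Type w} {T : LabeledRootedGraph V}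

/-! ### Direct successors in a rooted tree -/

theorem eq_snd_of_mem_directSuccessors (hT : T.IsTree) {a b : V} (h : b ∈ T.directSuccessors a)
    {p : T.graph.Walk b T.root} (hp : p.IsPath) : a = p.snd := by
  obtain ⟨hadj, -, q, hq, ha⟩ := h
  have : q = p :=
    congrArg Subtype.val ((hT.isAcyclic.subsingleton_path _ _).elim ⟨q, hq⟩ ⟨p, hp⟩)
  subst this
  exact hT.isAcyclic.eq_snd_of_adj_start hq hadj.symm ha

theorem directSuccessors_rightUnique (hT : T.IsTree) :
    Relator.RightUnique fun b a : V => b ∈ T.directSuccessors a := by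
  intro b a c ha hc
  obtain ⟨p, hp, -⟩ := ha.2.2
  rw [eq_snd_of_mem_directSuccessors hT ha hp, eq_snd_of_mem_directSuccessors hT hc hp]

theorem adj_iff_mem_directSuccessors (hT : T.IsTree) {a b : V} :
    T.graph.Adj a b ↔ b ∈ T.directSuccessors a ∨ a ∈ T.directSuccessors b := by
  refine ⟨fun h => ?_, fun h => h.elim (·.1) (·.1.symm)⟩
  obtain ⟨p, hp, -⟩ := hT.existsUnique_path a T.root
  by_cases hb : b ∈ p.support
  · exact .inr ⟨h.symm, h.ne', p, hp, hb⟩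
  · exact .inl ⟨h, h.ne, .cons h.symm p, hp.cons hb, by simp⟩

theorem directSuccessors_asymm (hT : T.IsTree) {a b : V} (h : b ∈ T.directSuccessors a) :
    a ∉ T.directSuccessors b := by
  intro h'
  obtain ⟨hadj, -, p, hp, ha⟩ := h
  obtain ⟨-, -, q, hq, hb⟩ := h'
  exact hT.isAcyclic.ne_mem_support_of_support_of_adj_of_isPath hp.reverse hq.reverse
    hadj.symm (by simpa using ha) (by simpa using hb)

theorem reflTransGen_root (hT : T.IsTree) (a : V) :
    Relation.ReflTransGen (fun b a : V => b ∈ T.directSuccessors a) a T.root := by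
  obtain ⟨p, hp, -⟩ := hT.existsUnique_path a T.root
  generalize hr : T.root = r at p hp
  induction p with
  | nil => exact .refl
  | cons h p ih =>
    subst hr
    refine .head ⟨h.symm, h.ne', .cons h p, hp, by simp⟩ (ih rfl hp.of_cons)

theorem outDegree_eq_zero_iff [Finite V] {a : V} : T.outDegree a = 0 ↔ T.directSuccessors a = ∅ :=
  Set.ncard_eq_zero

/-- At most one neighbour of `a` is not a direct successor of it. The hypothesis `ha` excludes a
root of degree one, which is a leaf although it has a direct successor. -/
theorem mem_leaves_iff [Finite V] (hT : T.IsTree) {a : V} (ha : T.outDegree a ≠ 1) :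
    a ∈ T.leaves ↔ T.directSuccessors a = ∅ := by
  rw [← outDegree_eq_zero_iff]
  have hsub : T.directSuccessors a ⊆ T.graph.neighborSet a := fun b hb => hb.1
  constructor
  · intro h
    have h1 : T.outDegree a ≤ _ := Set.ncard_le_ncard hsub
    have h2 : (T.graph.neighborSet a).ncard < 2 := h
    omega
  · intro h
    have h0 := outDegree_eq_zero_iff.1 h
    refine Nat.lt_succ_of_le ((Set.ncard_le_one_iff (Set.toFinite _)).2 fun {b c} hb hc => ?_)
    have key : ∀ {b}, b ∈ T.graph.neighborSet a → a ∈ T.directSuccessors b := fun hb =>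
      ((adj_iff_mem_directSuccessors hT).1 hb).resolve_left (by simp [h0])
    exact directSuccessors_rightUnique hT (key hb) (key hc)

/-! ### The tree conditions and their invariance under isomorphism -/

/-- The conditions that characterise the representing trees of `n`-th iterated balleans. -/
def IsIteratedBalleanTree (T : LabeledRootedGraph V) (n : ℕ) : Prop :=
  (∀ x : V, T.outDegree x ∉ Set.Icc 1 (n + 1)) ∧
  (∀ x : V, T.outDegree x = 0 ↔ T.label x = 0) ∧
  (∀ x y : V, y ∈ T.directSuccessors x → T.label y < T.label x) ∧
  (∀ x : V, x ∉ T.leaves → n ≤ (T.directSuccessors x ∩ T.leaves).ncard)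

theorem Isomorphic.symm {T' : LabeledRootedGraph W} (h : T.Isomorphic T') : T'.Isomorphic T := by
  obtain ⟨f, hr, hl⟩ := h
  exact ⟨f.symm, by simp [← hr], fun x => by simp [← hl]⟩

theorem Isomorphic.trans {Z : Type v} {T' : LabeledRootedGraph W} {T'' : LabeledRootedGraph Z}
    (h : T.Isomorphic T') (h' : T'.Isomorphic T'') : T.Isomorphic T'' := by
  obtain ⟨f, hr, hl⟩ := h
  obtain ⟨g, hr', hl'⟩ := h'
  exact ⟨f.trans g, by simp [hr, hr'], fun x => by simp [hl, hl']⟩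

theorem Isomorphic.isTree {T' : LabeledRootedGraph W} (h : T.Isomorphic T') (hT : T.IsTree) :
    T'.IsTree := by
  obtain ⟨f, -⟩ := h
  exact f.isTree_iff.1 hT

theorem map_mem_directSuccessors {T' : LabeledRootedGraph W} (f : T.graph ≃g T'.graph)
    (hr : f T.root = T'.root) {a b : V} (h : b ∈ T.directSuccessors a) :
    f b ∈ T'.directSuccessors (f a) := by
  obtain ⟨hadj, hne, p, hp, ha⟩ := h
  refine ⟨f.map_adj_iff.2 hadj, f.injective.ne hne, (p.map f.toHom).copy rfl hr, ?_, ?_⟩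
  · simpa using hp.map f.injective
  · simpa using ha

theorem image_directSuccessors {T' : LabeledRootedGraph W} (f : T.graph ≃g T'.graph)
    (hr : f T.root = T'.root) (a : V) :
    f '' T.directSuccessors a = T'.directSuccessors (f a) := by
  ext b
  constructor
  · rintro ⟨b, hb, rfl⟩
    exact map_mem_directSuccessors f hr hb
  · intro hb
    refine ⟨f.symm b, ?_, by simp⟩
    simpa using map_mem_directSuccessors f.symm (by simp [← hr]) hb

theorem image_leaves {T' : LabeledRootedGraph W} (f : T.graph ≃g T'.graph) :
    f '' T.leaves = T'.leaves := by
  have key : ∀ a, (T'.graph.neighborSet (f a)).ncard = (T.graph.neighborSet a).ncard := by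
    intro a
    rw [← Set.ncard_image_of_injective _ f.injective]
    congr 1
    ext b
    constructor
    · intro hb
      exact ⟨f.symm b, f.map_adj_iff.1 (by simpa using hb), by simp⟩
    · rintro ⟨b, hb, rfl⟩
      exact f.map_adj_iff.2 hb
  ext b
  obtain ⟨a, rfl⟩ := f.surjective b
  simp [leaves, key]

theorem Isomorphic.isIteratedBalleanTree {T' : LabeledRootedGraph W} (h : T.Isomorphic T') {n : ℕ}
    (hT : T.IsIteratedBalleanTree n) : T'.IsIteratedBalleanTree n := by
  obtain ⟨f, hr, hl⟩ := h
  have hout : ∀ a, T'.outDegree (f a) = T.outDegree a := fun a => by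
    rw [outDegree, ← image_directSuccessors f hr, Set.ncard_image_of_injective _ f.injective]
    rfl
  obtain ⟨h1, h2, h3, h4⟩ := hT
  refine ⟨?_, ?_, ?_, ?_⟩
  · simpa [f.surjective.forall, hout] using h1
  · simpa [f.surjective.forall, hout, hl] using h2
  · simpa [f.surjective.forall, hl, ← image_directSuccessors f hr] using h3
  · simp only [f.surjective.forall, ← image_directSuccessors f hr, ← image_leaves f,
      ← Set.image_inter f.injective, Set.ncard_image_of_injective _ f.injective,
      f.injective.mem_set_image]
    exact h4

end LabeledRootedGraph

/-! ### Balls in finite ultrametric spaces -/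

section UltrametricBalls

variable {X : Type u} [MetricSpace X]

/-- A nonempty set that contains, around each of its points, the closed ball whose radius is the
diameter of the set. In a finite ultrametric space these sets are exactly the closed balls. -/
def IsUltrametricBall (A : Set X) : Prop :=
  A.Nonempty ∧ ∀ x ∈ A, ∀ z, dist x z ≤ Metric.diam A → z ∈ A

variable {A B : Set X} {x y : X}

theorem dist_le_diam_of_finite [Finite X] (hx : x ∈ A) (hy : y ∈ A) : dist x y ≤ Metric.diam A :=
  Metric.dist_le_diam_of_mem (Set.toFinite A).isBounded hx hy

theorem diam_pos_of_nontrivial [Finite X] (hA : A.Nontrivial) : 0 < Metric.diam A := by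
  obtain ⟨x, hx, y, hy, hxy⟩ := hA
  exact (dist_pos.2 hxy).trans_le (dist_le_diam_of_finite hx hy)

theorem nontrivial_of_diam_ne_zero (h : Metric.diam A ≠ 0) : A.Nontrivial := by
  by_contra hA
  exact h (Metric.diam_subsingleton (Set.not_nontrivial_iff.1 hA))

/-- Two points of `A` are never farther apart than the more distant of them is from `x`, so the
eccentricity of every point is the diameter. -/
theorem exists_dist_eq_diam [Finite X] [IsUltrametricDist X] (hx : x ∈ A) :
    ∃ z ∈ A, dist x z = Metric.diam A := by
  obtain ⟨z, hz, h⟩ := Set.exists_max_image A (dist x) (Set.toFinite A) ⟨x, hx⟩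
  refine ⟨z, hz, (dist_le_diam_of_finite hx hz).antisymm ?_⟩
  refine Metric.diam_le_of_forall_dist_le dist_nonneg fun a ha b hb => ?_
  exact (dist_triangle_max a x b).trans (max_le (dist_comm a x ▸ h a ha) (h b hb))

theorem dist_eq_of_dist_lt [IsUltrametricDist X] {z : X} (h : dist x y < dist x z) :
    dist y z = dist x z := by
  apply le_antisymm
  · exact (dist_triangle_max y x z).trans (max_le (dist_comm x y ▸ h.le) le_rfl)
  · exact (le_max_iff.1 (dist_triangle_max x y z)).resolve_left h.not_ge

namespace IsUltrametricBall

theorem subset_of_mem [Finite X] (hB : IsUltrametricBall B)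
    (hxA : x ∈ A) (hxB : x ∈ B) (h : Metric.diam A ≤ Metric.diam B) : A ⊆ B := fun z hz =>
  hB.2 x hxB z ((dist_le_diam_of_finite hxA hz).trans h)

theorem eq_of_mem [Finite X] (hA : IsUltrametricBall A) (hB : IsUltrametricBall B)
    (hxA : x ∈ A) (hxB : x ∈ B) (h : Metric.diam A = Metric.diam B) : A = B :=
  (hB.subset_of_mem hxA hxB h.le).antisymm (hA.subset_of_mem hxB hxA h.ge)

variable [IsUltrametricDist X]

theorem diam_closedBall_le {r : ℝ} (hr : 0 ≤ r) : Metric.diam (Metric.closedBall x r) ≤ r :=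
  Metric.diam_le_of_forall_dist_le hr fun a ha b hb =>
    (dist_triangle_max a x b).trans (max_le ha (Metric.mem_closedBall'.1 hb))

theorem closedBall {r : ℝ} (hr : 0 ≤ r) : IsUltrametricBall (Metric.closedBall x r) := by
  refine ⟨⟨x, Metric.mem_closedBall_self hr⟩, fun y hy z hz => ?_⟩
  rw [Metric.mem_closedBall'] at hy ⊢
  exact (dist_triangle_max x y z).trans (max_le hy (hz.trans (diam_closedBall_le hr)))

theorem diam_closedBall_dist [Finite X] :
    Metric.diam (Metric.closedBall x (dist x y)) = dist x y :=
  (diam_closedBall_le dist_nonneg).antisymm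
    (dist_le_diam_of_finite (Metric.mem_closedBall_self dist_nonneg) (Metric.mem_closedBall'.2 le_rfl))

end IsUltrametricBall

/-- Every closed ball with more than one point contains `n + 2` points at pairwise distance equal
to the diameter of the ball, and `n` points whose distance to every other point of the ball is
that diameter. -/
def IsIteratedBalleanSpace (n : ℕ) (X : Type u) [MetricSpace X] : Prop :=
  ∀ x y : X, x ≠ y →
    (∃ S : Finset X, n + 2 ≤ S.card ∧ (∀ s ∈ S, dist x s ≤ dist x y) ∧
      ∀ s ∈ S, ∀ t ∈ S, s ≠ t → dist s t = dist x y) ∧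
    ∃ S : Finset X, n ≤ S.card ∧ ∀ s ∈ S, dist x s ≤ dist x y ∧
      ∀ w, dist x w ≤ dist x y → w ≠ s → dist s w = dist x y

/-- `A` is the closed ball about any of its points `x` whose radius is the distance to a point of
`A` farthest from `x`. -/
theorem IsIteratedBalleanSpace.of_ball {n : ℕ} [Finite X] [IsUltrametricDist X]
    (h : IsIteratedBalleanSpace n X) (hA : IsUltrametricBall A) (hn : A.Nontrivial) :
    (∃ S : Finset X, n + 2 ≤ S.card ∧ (∀ s ∈ S, s ∈ A) ∧
      ∀ s ∈ S, ∀ t ∈ S, s ≠ t → dist s t = Metric.diam A) ∧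
    ∃ S : Finset X, n ≤ S.card ∧ ∀ s ∈ S, s ∈ A ∧
      ∀ w ∈ A, w ≠ s → dist s w = Metric.diam A := by
  obtain ⟨x, hx⟩ := hA.1
  obtain ⟨y, hy, hxy⟩ := exists_dist_eq_diam hx
  have hne : x ≠ y := by
    rintro rfl
    rw [dist_self] at hxy
    exact (diam_pos_of_nontrivial hn).ne hxy
  have hmem : ∀ z, dist x z ≤ Metric.diam A ↔ z ∈ A := fun z =>
    ⟨hA.2 x hx z, fun hz => dist_le_diam_of_finite hx hz⟩
  have := h x y hne
  simpa only [hxy, hmem] using this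

end UltrametricBalls

/-! ### Levels of the representing tree -/

section RepresentingTree

variable {X : Type u} [MetricSpace X]

theorem isUltrametricBall_univ [Nonempty X] : IsUltrametricBall (Set.univ : Set X) :=
  ⟨Set.univ_nonempty, fun _ _ _ _ => trivial⟩

/-- The parts are the traces on `A` of open balls of radius `diam A`. The center belongs to its own
part because a nontrivial `A` has positive diameter. -/
theorem isNextLevel_iff [Finite X] {A B : Set X} :
    IsNextLevel A B ↔ A.Nontrivial ∧ ∃ x ∈ A, B = {y ∈ A | dist x y < Metric.diam A} := by
  refine and_congr_right fun hA => ?_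
  have key : ∀ x : A, Subtype.val '' {y : A | ¬ (diametricalGraph A).Adj x y} =
      {y ∈ A | dist x.1 y < Metric.diam A} := by
    rintro ⟨x, hx⟩
    ext y
    constructor
    · rintro ⟨⟨y, hy⟩, h, rfl⟩
      refine ⟨hy, (dist_le_diam_of_finite hx hy).lt_of_ne fun he => h ⟨?_, he⟩⟩
      rintro h
      obtain rfl : x = y := congrArg Subtype.val h
      exact (diam_pos_of_nontrivial hA).ne (by simpa using he)
    · rintro ⟨hy, h⟩
      exact ⟨⟨y, hy⟩, fun h' => h.ne h'.2, rfl⟩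
  constructor
  · rintro ⟨x, rfl⟩
    exact ⟨x, x.2, key x⟩
  · rintro ⟨x, hx, rfl⟩
    exact ⟨⟨x, hx⟩, (key ⟨x, hx⟩).symm⟩

variable [Finite X] {A B : Set X}

theorem IsNextLevel.subset (h : IsNextLevel A B) : B ⊆ A := by
  obtain ⟨-, x, hx, rfl⟩ := isNextLevel_iff.1 h
  exact Set.sep_subset _ _

theorem IsNextLevel.nonempty (h : IsNextLevel A B) : B.Nonempty := by
  obtain ⟨hA, x, hx, rfl⟩ := isNextLevel_iff.1 h
  exact ⟨x, hx, by simpa using diam_pos_of_nontrivial hA⟩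

theorem isNextLevel_part {x : X} (hA : A.Nontrivial) (hx : x ∈ A) :
    IsNextLevel A {y ∈ A | dist x y < Metric.diam A} :=
  isNextLevel_iff.2 ⟨hA, x, hx, rfl⟩

theorem mem_part {x : X} (hA : A.Nontrivial) (hx : x ∈ A) :
    x ∈ {y ∈ A | dist x y < Metric.diam A} :=
  ⟨hx, by simpa using diam_pos_of_nontrivial hA⟩

variable [IsUltrametricDist X]

theorem IsNextLevel.eq_of_mem {x : X} (h : IsNextLevel A B) (hx : x ∈ B) :
    B = {y ∈ A | dist x y < Metric.diam A} := by
  obtain ⟨-, z, hz, rfl⟩ := isNextLevel_iff.1 h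
  ext y
  refine and_congr_right fun hy => ⟨fun h => ?_, fun h => ?_⟩
  · exact (dist_triangle_max x z y).trans_lt (max_lt (dist_comm z x ▸ hx.2) h)
  · exact (dist_triangle_max z x y).trans_lt (max_lt hx.2 h)

theorem IsNextLevel.diam_lt (h : IsNextLevel A B) : Metric.diam B < Metric.diam A := by
  obtain ⟨x, hx⟩ := h.nonempty
  obtain ⟨z, hz, hd⟩ := exists_dist_eq_diam hx
  rw [h.eq_of_mem hx] at hz
  exact hd ▸ hz.2

theorem IsNextLevel.eq_of_common {B' : Set X} {x : X} (h : IsNextLevel A B) (h' : IsNextLevel A B')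
    (hx : x ∈ B) (hx' : x ∈ B') : B = B' := by
  rw [h.eq_of_mem hx, h'.eq_of_mem hx']

theorem IsNextLevel.dist_eq {B' : Set X} {x y : X} (h : IsNextLevel A B) (h' : IsNextLevel A B')
    (hne : B ≠ B') (hx : x ∈ B) (hy : y ∈ B') : dist x y = Metric.diam A := by
  refine (dist_le_diam_of_finite (h.subset hx) (h'.subset hy)).eq_of_not_lt fun hlt => hne ?_
  refine h.eq_of_common h' (x := y) ?_ hy
  rw [h.eq_of_mem hx]
  exact ⟨h'.subset hy, hlt⟩

theorem IsUltrametricBall.of_isNextLevel (hA : IsUltrametricBall A) (h : IsNextLevel A B) :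
    IsUltrametricBall B := by
  refine ⟨h.nonempty, fun x hx z hz => ?_⟩
  rw [h.eq_of_mem hx]
  have := hz.trans_lt h.diam_lt
  exact ⟨hA.2 x (h.subset hx) z this.le, this⟩

theorem IsRepresentingVertex.isUltrametricBall [Nonempty X] (h : IsRepresentingVertex X A) :
    IsUltrametricBall A := by
  induction h with
  | root => exact isUltrametricBall_univ
  | next _ hB ih => exact ih.of_isNextLevel hB

/-- Among the vertices containing both points take one of least diameter. Were the points closer
than this diameter, the part of `x` would contain both and have a smaller diameter. -/
theorem exists_isRepresentingVertex_dist_eq_diam {x y : X} (hxy : x ≠ y) :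
    ∃ A, IsRepresentingVertex X A ∧ x ∈ A ∧ y ∈ A ∧ dist x y = Metric.diam A := by
  obtain ⟨A, ⟨hA, hx, hy⟩, hmin⟩ := Set.exists_min_image
    {A : Set X | IsRepresentingVertex X A ∧ x ∈ A ∧ y ∈ A} Metric.diam (Set.toFinite _)
    ⟨Set.univ, .root, trivial, trivial⟩
  refine ⟨A, hA, hx, hy, (dist_le_diam_of_finite hx hy).eq_of_not_lt fun hlt => ?_⟩
  have hn : A.Nontrivial := ⟨x, hx, y, hy, hxy⟩
  have hB := isNextLevel_part hn hx
  exact hB.diam_lt.not_ge (hmin _ ⟨hA.next hB, mem_part hn hx, hy, hlt⟩)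

theorem exists_isPath_representingTree (A : {A : Set X // IsRepresentingVertex X A}) :
    ∃ p : (representingTree X).graph.Walk A (representingTree X).root,
      p.IsPath ∧ ∀ C ∈ p.support, A.1 ⊆ C.1 := by
  obtain ⟨A, hA⟩ := A
  induction hA with
  | root =>
    refine ⟨.nil, .nil, fun C hC => ?_⟩
    obtain rfl := List.mem_singleton.1 hC
    exact subset_rfl
  | @next A B hA h ih =>
    obtain ⟨p, hp, hs⟩ := ih
    have hadj : (representingTree X).graph.Adj ⟨B, hA.next h⟩ ⟨A, hA⟩ := by
      refine ⟨fun he => ?_, .inr h⟩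
      exact h.diam_lt.ne (congrArg (fun C => Metric.diam C.1) he)
    refine ⟨.cons hadj p, hp.cons fun hB => ?_, ?_⟩
    · exact h.diam_lt.not_ge (Metric.diam_mono (hs _ hB) (Set.toFinite B).isBounded)
    · simp only [SimpleGraph.Walk.support_cons, List.mem_cons, forall_eq_or_imp]
      exact ⟨subset_rfl, fun C hC => h.subset.trans (hs C hC)⟩

/-- The path from `A` to the root passes only through supersets of `A`, so it avoids the part `B`
and extends to a path from `B` through `A`. In the main theorem `hT` is transported along an
isomorphism with the given tree. -/
theorem mem_directSuccessors_representingTree (hT : (representingTree X).IsTree)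
    {A B : {A : Set X // IsRepresentingVertex X A}} :
    B ∈ (representingTree X).directSuccessors A ↔ IsNextLevel A.1 B.1 := by
  have key : ∀ {A B : {A : Set X // IsRepresentingVertex X A}}, IsNextLevel A.1 B.1 →
      B ∈ (representingTree X).directSuccessors A := by
    intro A B h
    have hne : A ≠ B := fun he => h.diam_lt.ne (congrArg (fun C => Metric.diam C.1) he.symm)
    have hadj : (representingTree X).graph.Adj A B := ⟨hne, .inl h⟩
    obtain ⟨p, hp, hs⟩ := exists_isPath_representingTree A
    refine ⟨hadj, hne, .cons hadj.symm p, hp.cons fun hB => ?_, by simp⟩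
    exact h.diam_lt.not_ge (Metric.diam_mono (hs _ hB) (Set.toFinite _).isBounded)
  refine ⟨fun h => ?_, key⟩
  obtain ⟨-, h' | h'⟩ := h.1
  · exact h'
  · exact absurd h (LabeledRootedGraph.directSuccessors_asymm hT (key h'))

end RepresentingTree

/-! ### The tree conditions as a metric condition -/

section RepresentingTree

variable {X : Type u} [MetricSpace X] [Finite X] [IsUltrametricDist X]

theorem directSuccessors_representingTree_eq_empty_iff (hT : (representingTree X).IsTree)
    {A : {A : Set X // IsRepresentingVertex X A}} :
    (representingTree X).directSuccessors A = ∅ ↔ ¬ A.1.Nontrivial := by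
  rw [Set.eq_empty_iff_forall_notMem]
  constructor
  · intro h hA
    obtain ⟨x, hx, -⟩ := id hA
    have := isNextLevel_part hA hx
    exact h ⟨_, A.2.next this⟩ ((mem_directSuccessors_representingTree hT).2 this)
  · intro h B hB
    exact h ((mem_directSuccessors_representingTree hT).1 hB).1

theorem mem_leaves_representingTree [Nonempty X] (hT : (representingTree X).IsTree)
    {A : {A : Set X // IsRepresentingVertex X A}} :
    A ∈ (representingTree X).leaves ↔ ¬ A.1.Nontrivial := by
  rw [← directSuccessors_representingTree_eq_empty_iff hT]
  refine LabeledRootedGraph.mem_leaves_iff hT fun h => ?_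
  obtain ⟨B, hB⟩ := Set.ncard_eq_one.1 h
  have hmem : ∀ C : {A : Set X // IsRepresentingVertex X A}, IsNextLevel A.1 C.1 → C = B := by
    intro C hC
    have := (mem_directSuccessors_representingTree hT).2 hC
    rwa [hB] at this
  have hAB : IsNextLevel A.1 B.1 :=
    (mem_directSuccessors_representingTree hT).1 (hB ▸ Set.mem_singleton B)
  obtain ⟨x, hx⟩ := hAB.nonempty
  -- A point `y` at distance `diam A` from `x` lies in a second part, so the out-degree cannot be
  -- one.
  obtain ⟨y, hy, hxy⟩ := exists_dist_eq_diam (hAB.subset hx)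
  have hC := isNextLevel_part hAB.1 hy
  have hyB := mem_part hAB.1 hy
  have : {z ∈ A.1 | dist y z < Metric.diam A.1} = B.1 :=
    congrArg Subtype.val (hmem ⟨_, A.2.next hC⟩ hC)
  rw [this, hAB.eq_of_mem hx] at hyB
  exact hyB.2.ne hxy

theorem isIteratedBalleanTree_representingTree [Nonempty X] (hT : (representingTree X).IsTree)
    {n : ℕ} (hX : IsIteratedBalleanSpace n X) :
    (representingTree X).IsIteratedBalleanTree n := by
  have hball := fun A : {A : Set X // IsRepresentingVertex X A} => A.2.isUltrametricBall
  have hout : ∀ A : {A : Set X // IsRepresentingVertex X A},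
      (representingTree X).outDegree A = 0 ↔ ¬ A.1.Nontrivial := fun A =>
    LabeledRootedGraph.outDegree_eq_zero_iff.trans
      (directSuccessors_representingTree_eq_empty_iff hT)
  refine ⟨?_, ?_, ?_, ?_⟩
  · rintro A ⟨h1, h2⟩
    have hA : A.1.Nontrivial := by
      by_contra h
      have := (hout A).2 h
      omega
    obtain ⟨⟨S, hS, hSA, hd⟩, -⟩ := hX.of_ball (hball A) hA
    -- Points at distance `diam A` lie in different parts, so sending a point to its part is
    -- injective.
    let f : S → (representingTree X).directSuccessors A := fun s =>
      ⟨⟨_, A.2.next (isNextLevel_part hA (hSA s s.2))⟩,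
        (mem_directSuccessors_representingTree hT).2 (isNextLevel_part hA (hSA s s.2))⟩
    have hf : Function.Injective f := by
      intro s t hst
      by_contra hne
      have ht := mem_part hA (hSA t t.2)
      have : {y ∈ A.1 | dist s.1 y < Metric.diam A.1} = {y ∈ A.1 | dist t.1 y < Metric.diam A.1} :=
        congrArg (fun B => B.1.1) hst
      rw [← this] at ht
      exact ht.2.ne (hd s s.2 t t.2 fun h => hne (Subtype.ext h))
    have := Nat.card_le_card_of_injective f hf
    rw [Nat.card_eq_fintype_card, Fintype.card_coe, Nat.card_coe_set_eq] at this
    change S.card ≤ (representingTree X).outDegree A at this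
    omega
  · intro A
    rw [hout, ← NNReal.coe_eq_zero]
    change _ ↔ Metric.diam A.1 = 0
    exact ⟨fun h => Metric.diam_subsingleton (Set.not_nontrivial_iff.1 h),
      fun h h' => (diam_pos_of_nontrivial h').ne' h⟩
  · intro A B h
    exact ((mem_directSuccessors_representingTree hT).1 h).diam_lt
  · intro A h
    rw [mem_leaves_representingTree hT, not_not] at h
    obtain ⟨-, S, hS, hd⟩ := hX.of_ball (hball A) h
    have hpart : ∀ s ∈ S, {y ∈ A.1 | dist s y < Metric.diam A.1} = {s} := by
      intro s hs
      ext y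
      refine ⟨fun hy => ?_, ?_⟩
      · by_contra hne
        exact hy.2.ne ((hd s hs).2 y hy.1 hne)
      · rintro rfl
        exact mem_part h (hd y hs).1
    have hnext : ∀ s ∈ S, IsNextLevel A.1 {s} := fun s hs =>
      hpart s hs ▸ isNextLevel_part h (hd s hs).1
    let f : S → ((representingTree X).directSuccessors A ∩ (representingTree X).leaves : Set _) :=
      fun s => ⟨⟨{s.1}, A.2.next (hnext s s.2)⟩,
        (mem_directSuccessors_representingTree hT).2 (hnext s s.2),
        (mem_leaves_representingTree hT).2 (by simp)⟩
    have hf : Function.Injective f := by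
      intro s t hst
      have : ({s.1} : Set X) = {t.1} := congrArg (fun B => B.1.1) hst
      exact Subtype.ext (Set.singleton_injective this)
    have := Nat.card_le_card_of_injective f hf
    rw [Nat.card_eq_fintype_card, Fintype.card_coe, Nat.card_coe_set_eq] at this
    omega

theorem isIteratedBalleanSpace_of_representingTree [Nonempty X]
    (hT : (representingTree X).IsTree) {n : ℕ}
    (hX : (representingTree X).IsIteratedBalleanTree n) : IsIteratedBalleanSpace n X := by
  intro x y hxy
  obtain ⟨A, hA, hx, hy, hd⟩ := exists_isRepresentingVertex_dist_eq_diam hxy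
  have hn : A.Nontrivial := ⟨x, hx, y, hy, hxy⟩
  have hAb := hA.isUltrametricBall
  have hmem : ∀ z, dist x z ≤ Metric.diam A ↔ z ∈ A := fun z =>
    ⟨hAb.2 x hx z, fun hz => dist_le_diam_of_finite hx hz⟩
  simp only [hd, hmem]
  obtain ⟨h1, -, -, h4⟩ := hX
  classical
  -- pick a point in each member of a set of parts
  have hrep : ∀ P : Set {A : Set X // IsRepresentingVertex X A},
      P ⊆ (representingTree X).directSuccessors ⟨A, hA⟩ →
      ∃ S : Finset X, S.card = P.ncard ∧ (∀ s ∈ S, ∃ B ∈ P, s ∈ B.1) ∧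
        (∀ s ∈ S, ∀ t ∈ S, s ≠ t → dist s t = Metric.diam A) := by
    intro P hP
    have hP' : ∀ B ∈ P, IsNextLevel A B.1 := fun B hB =>
      (mem_directSuccessors_representingTree hT).1 (hP hB)
    choose! g hg using fun B (hB : B ∈ P) => (hP' B hB).nonempty
    have hinj : Set.InjOn g P := fun B hB C hC hBC =>
      Subtype.ext ((hP' B hB).eq_of_common (hP' C hC) (hg B hB) (hBC ▸ hg C hC))
    refine ⟨(Set.toFinite (g '' P)).toFinset, ?_, ?_, ?_⟩
    · rw [← Set.ncard_eq_toFinset_card, hinj.ncard_image]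
    · simp only [Set.Finite.mem_toFinset, Set.forall_mem_image]
      exact fun B hB => ⟨B, hB, hg B hB⟩
    · simp only [Set.Finite.mem_toFinset, Set.forall_mem_image]
      exact fun B hB C hC hne => (hP' B hB).dist_eq (hP' C hC)
        (fun h => hne (congrArg g (Subtype.ext h))) (hg B hB) (hg C hC)
  constructor
  · obtain ⟨S, hS, hSP, hd⟩ := hrep _ subset_rfl
    refine ⟨S, ?_, fun s hs => ?_, hd⟩
    -- The out-degree is nonzero and avoids `1, …, n + 1`, so it is at least `n + 2`.
    · have h0 := h1 ⟨A, hA⟩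
      have h0' : (representingTree X).outDegree ⟨A, hA⟩ ≠ 0 := fun h =>
        (directSuccessors_representingTree_eq_empty_iff hT).1
          (LabeledRootedGraph.outDegree_eq_zero_iff.1 h) hn
      rw [Set.mem_Icc] at h0
      rw [hS]
      change _ ≤ (representingTree X).outDegree ⟨A, hA⟩
      omega
    · obtain ⟨B, hB, hsB⟩ := hSP s hs
      exact ((mem_directSuccessors_representingTree hT).1 hB).subset hsB
  · obtain ⟨S, hS, hSP, hd⟩ := hrep _ Set.inter_subset_left
    refine ⟨S, hS ▸ h4 ⟨A, hA⟩ ?_, fun s hs => ?_⟩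
    · rw [mem_leaves_representingTree hT, not_not]
      exact hn
    · obtain ⟨B, ⟨hB, hBl⟩, hsB⟩ := hSP s hs
      have hAB : IsNextLevel A B.1 := (mem_directSuccessors_representingTree hT).1 hB
      rw [mem_leaves_representingTree hT, Set.not_nontrivial_iff] at hBl
      refine ⟨hAB.subset hsB, fun w hw hne => ?_⟩
      refine (dist_le_diam_of_finite (hAB.subset hsB) hw).eq_of_not_lt fun hlt => hne ?_
      refine hBl ?_ hsB
      rw [hAB.eq_of_mem hsB]
      exact ⟨hw, hlt⟩

end RepresentingTree

/-! ### The Hausdorff distance between balls -/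

namespace Ballean

variable {X : Type u} [MetricSpace X]

/-- The closed ball with center `x` and radius `dist x y`. -/
def ofDist (x y : X) : Ballean X :=
  ⟨Metric.closedBall x (dist x y), x, dist x y, dist_nonneg, rfl⟩

/-- The one-point ball. -/
def point (x : X) : Ballean X :=
  ⟨{x}, x, 0, le_rfl, Metric.closedBall_zero.symm⟩

theorem point_injective : Function.Injective (point : X → Ballean X) := fun _ _ h =>
  Set.singleton_injective (congrArg Subtype.val h)

variable [IsUltrametricDist X]

theorem isUltrametricBall (B : Ballean X) : IsUltrametricBall B.1 := by
  obtain ⟨c, r, hr, h⟩ := B.2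
  rw [h]
  exact .closedBall hr

variable [Finite X]

theorem dist_le {B C : Ballean X} {b c : X} (hb : b ∈ B.1) (hc : c ∈ C.1) :
    dist B C ≤ max (max (Metric.diam B.1) (Metric.diam C.1)) (dist b c) := by
  refine Metric.hausdorffDist_le_of_mem_dist (le_max_of_le_right dist_nonneg) ?_ ?_
  · intro x hx
    refine ⟨c, hc, (dist_triangle_max x b c).trans (max_le_max_right _ ?_)⟩
    exact (dist_le_diam_of_finite hx hb).trans (le_max_left _ _)
  · intro x hx
    refine ⟨b, hb, (dist_triangle_max x c b).trans (max_le ?_ ?_)⟩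
    · exact (dist_le_diam_of_finite hx hc).trans (le_max_of_le_left (le_max_right _ _))
    · exact dist_comm b c ▸ le_max_right _ _

/-- If `dist b c` exceeds both diameters, every point of `B` is at that distance from every point of
`C`. Otherwise `B` is a proper subset of `C` of smaller diameter, and a point of `C` at distance
`diam C` from `b` is equally far from all of `B`. -/
theorem dist_eq_of_diam_le {B C : Ballean X} (hne : B ≠ C) {b c : X} (hb : b ∈ B.1)
    (hc : c ∈ C.1) (h : Metric.diam B.1 ≤ Metric.diam C.1) :
    dist B C = max (Metric.diam C.1) (dist b c) := by
  have hle := dist_le hb hc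
  rw [max_eq_right h] at hle
  refine hle.eq_of_not_lt fun hlt => ?_
  have hfin := hausdorffEDist_ne_top B C
  rcases lt_or_ge (Metric.diam C.1) (dist b c) with h' | h'
  · rw [max_eq_right h'.le] at hlt
    obtain ⟨y, hy, hby⟩ := Metric.exists_dist_lt_of_hausdorffDist_lt hb hlt hfin
    refine (dist_triangle_max b y c).not_gt (max_lt hby ?_)
    exact (dist_le_diam_of_finite hy hc).trans_lt h'
  · rw [max_eq_left h'] at hlt
    have hbC : b ∈ C.1 := C.isUltrametricBall.2 c hc b (dist_comm b c ▸ h')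
    obtain ⟨z, hz, hbz⟩ := exists_dist_eq_diam hbC
    obtain ⟨w, hw, hwz⟩ := Metric.exists_dist_lt_of_hausdorffDist_lt' hz hlt hfin
    refine hne (Subtype.ext (B.isUltrametricBall.eq_of_mem C.isUltrametricBall hb hbC
      (h.antisymm ?_)))
    refine le_of_not_gt fun h'' => hbz.not_lt ((dist_triangle_max b w z).trans_lt (max_lt ?_ hwz))
    exact (dist_le_diam_of_finite hb hw).trans_lt h''

theorem dist_eq {B C : Ballean X} (hne : B ≠ C) {b c : X} (hb : b ∈ B.1) (hc : c ∈ C.1) :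
    dist B C = max (max (Metric.diam B.1) (Metric.diam C.1)) (dist b c) := by
  rcases le_total (Metric.diam B.1) (Metric.diam C.1) with h | h
  · rw [max_eq_right h, dist_eq_of_diam_le hne hb hc h]
  · rw [max_eq_left h, dist_comm, dist_eq_of_diam_le hne.symm hc hb h, dist_comm b c]

theorem dist_point_eq {C : Ballean X} {b c : X} (hne : point b ≠ C) (hc : c ∈ C.1) :
    dist (point b) C = max (Metric.diam C.1) (dist b c) :=
  dist_eq_of_diam_le hne (Set.mem_singleton b) hc
    ((Metric.diam_subsingleton Set.subsingleton_singleton).trans_le Metric.diam_nonneg)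

/-- The closed ball of radius `r` about `B` in the ballean consists of the balls contained in the
closed ball of radius `r` about `b`. The bound `hr` covers the case `B = C`. -/
theorem dist_le_iff {B C : Ballean X} {b : X} {r : ℝ} (hb : b ∈ B.1) (hr : Metric.diam B.1 ≤ r) :
    dist B C ≤ r ↔ Metric.diam C.1 ≤ r ∧ ∀ c ∈ C.1, dist b c ≤ r := by
  constructor
  · intro h
    by_cases hne : B = C
    · subst hne
      exact ⟨hr, fun c hc => (dist_le_diam_of_finite hb hc).trans hr⟩
    · have : ∀ c ∈ C.1, Metric.diam C.1 ≤ r ∧ dist b c ≤ r := by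
        intro c hc
        rw [dist_eq hne hb hc] at h
        exact ⟨(le_max_of_le_left (le_max_right _ _)).trans h, (le_max_right _ _).trans h⟩
      obtain ⟨c, hc⟩ := C.nonempty_val
      exact ⟨(this c hc).1, fun c hc => (this c hc).2⟩
  · rintro ⟨h1, h2⟩
    obtain ⟨c, hc⟩ := C.nonempty_val
    exact (dist_le hb hc).trans (max_le (max_le hr h1) (h2 c hc))

end Ballean

/-! ### The ballean raises the parameter by one -/

theorem isIteratedBalleanSpace_zero (X : Type u) [MetricSpace X] : IsIteratedBalleanSpace 0 X := by
  intro x y hxy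
  classical
  refine ⟨⟨{x, y}, by rw [Finset.card_pair hxy], ?_, ?_⟩, ∅, le_rfl, by simp⟩
  · simp
  · simp [hxy, hxy.symm, dist_comm y x]

variable {X : Type u} [MetricSpace X] [IsUltrametricDist X] [Finite X]

open Ballean in
theorem IsIteratedBalleanSpace.ballean {n : ℕ} (h : IsIteratedBalleanSpace n X) :
    IsIteratedBalleanSpace (n + 1) (Ballean X) := by
  intro B C hne
  obtain ⟨b, hb⟩ := B.nonempty_val
  have hr : 0 < dist B C := dist_pos.2 hne
  have hdB : Metric.diam B.1 ≤ dist B C := by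
    obtain ⟨c, hc⟩ := C.nonempty_val
    rw [dist_eq hne hb hc]
    exact le_max_of_le_left (le_max_left _ _)
  -- The distance of two balls is attained in `X` from `b`: by `c`, or by a farthest point of the
  -- ball of larger diameter when that ball contains `b`.
  obtain ⟨z, hz⟩ : ∃ z, dist b z = dist B C := by
    obtain ⟨c, hc⟩ := C.nonempty_val
    rw [dist_eq hne hb hc]
    rcases le_total (Metric.diam B.1) (Metric.diam C.1) with h | h
    · rw [max_eq_right h]
      rcases le_total (dist b c) (Metric.diam C.1) with h' | h'
      · rw [max_eq_left h']
        exact (exists_dist_eq_diam (C.isUltrametricBall.2 c hc b (dist_comm b c ▸ h'))).imp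
          fun _ h => h.2
      · exact ⟨c, (max_eq_right h').symm⟩
    · rw [max_eq_left h]
      rcases le_total (dist b c) (Metric.diam B.1) with h' | h'
      · rw [max_eq_left h']
        exact (exists_dist_eq_diam hb).imp fun _ h => h.2
      · exact ⟨c, (max_eq_right h').symm⟩
  have hbz : b ≠ z := dist_pos.1 (hz ▸ hr)
  obtain ⟨⟨S, hS, hSb, hSd⟩, S', hS', hSd'⟩ := h b z hbz
  simp only [hz] at hSb hSd hSd'
  set r := dist B C with hrdef
  -- `A` is the new point: it has diameter `r`, hence is at distance `r` from every other ball
  -- inside it, and it is not a one-point ball. It is added to the one-point balls of both old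
  -- families.
  let A : Ballean X := ofDist b z
  have hbA : b ∈ A.1 := Metric.mem_closedBall_self dist_nonneg
  have hAd : Metric.diam A.1 = r := hz ▸ IsUltrametricBall.diam_closedBall_dist
  have hmemA : ∀ {w}, dist b w ≤ r → w ∈ A.1 := fun {w} hw =>
    Metric.mem_closedBall'.2 (hz.symm ▸ hw)
  have hpA : ∀ s, point s ≠ A := fun s hs => by
    rw [← hs] at hAd
    exact hr.ne ((Metric.diam_subsingleton Set.subsingleton_singleton).symm.trans hAd)
  have hAW : ∀ W, dist B W ≤ r → W ≠ A → dist A W = r := by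
    intro W hW hWA
    obtain ⟨w, hw⟩ := W.nonempty_val
    obtain ⟨h1, h2⟩ := (dist_le_iff hb hdB).1 hW
    rw [dist_eq hWA.symm hbA hw, hAd, max_eq_left h1, max_eq_left (h2 w hw)]
  have hBA : dist B A ≤ r := (dist_le_iff hb hdB).2 ⟨hAd.le, fun c hc =>
    (dist_le_diam_of_finite hbA hc).trans hAd.le⟩
  have hBp : ∀ s, dist b s ≤ r → dist B (point s) ≤ r := by
    intro s hs
    refine (dist_le_iff hb hdB).2 ⟨?_, ?_⟩
    · exact (Metric.diam_subsingleton Set.subsingleton_singleton).trans_le hr.le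
    · rintro c rfl
      exact hs
  classical
  have hcard : ∀ S : Finset X,
      (insert A (S.map ⟨point, point_injective⟩)).card = S.card + 1 := by
    intro S
    rw [Finset.card_insert_of_notMem, Finset.card_map]
    simpa using fun s _ => hpA s
  refine ⟨⟨insert A (S.map ⟨point, point_injective⟩), ?_, ?_, ?_⟩,
    insert A (S'.map ⟨point, point_injective⟩), ?_, ?_⟩
  · rw [hcard]
    omega
  · simp only [Finset.mem_insert, Finset.mem_map, Function.Embedding.coeFn_mk, forall_eq_or_imp,
      forall_exists_index, and_imp, forall_apply_eq_imp_iff₂]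
    exact ⟨hBA, fun s hs => hBp s (hSb s hs)⟩
  · simp only [Finset.mem_insert, Finset.mem_map, Function.Embedding.coeFn_mk, forall_eq_or_imp,
      forall_exists_index, and_imp, forall_apply_eq_imp_iff₂]
    refine ⟨⟨fun h => absurd rfl h, fun s hs _ => hAW _ (hBp s (hSb s hs)) (hpA s)⟩,
      fun s hs => ⟨fun _ => ?_, fun t ht hst => ?_⟩⟩
    · rw [dist_comm]
      exact hAW _ (hBp s (hSb s hs)) (hpA s)
    · rw [dist_point_eq hst (Set.mem_singleton t),
        hSd s hs t ht fun h => hst (congrArg point h)]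
      exact max_eq_right
        ((Metric.diam_subsingleton Set.subsingleton_singleton).trans_le hr.le)
  · rw [hcard]
    omega
  · simp only [Finset.mem_insert, Finset.mem_map, Function.Embedding.coeFn_mk, forall_eq_or_imp,
      forall_exists_index, and_imp, forall_apply_eq_imp_iff₂]
    refine ⟨⟨hBA, hAW⟩, fun s hs => ⟨hBp s (hSd' s hs).1, fun W hW hne => ?_⟩⟩
    obtain ⟨h1, h2⟩ := (dist_le_iff hb hdB).1 hW
    -- A ball other than `{s}` contains a point other than `s`, and isolation of `s` puts that point
    -- at distance `r`.
    obtain ⟨w, hw, hws⟩ : ∃ w ∈ W.1, w ≠ s := by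
      by_contra! hall
      refine hne (Subtype.ext ?_)
      exact (Set.Nonempty.subset_singleton_iff W.nonempty_val).1 hall
    rw [dist_point_eq hne.symm hw, (hSd' s hs).2 w (h2 w hw) hws, max_eq_right h1]

theorem isIteratedBalleanSpace_iteratedBallean (X : FinUltrametricSpace.{u}) (n : ℕ) :
    IsIteratedBalleanSpace n (X.iteratedBallean n).carrier := by
  induction n with
  | zero => exact isIteratedBalleanSpace_zero _
  | succ n ih => exact ih.ballean

/-! ### Inverting the ballean by deleting selected points -/

section Selection

variable {Y : Type u} [MetricSpace Y]

/-- `p` selects, in every ball, a point whose distance to each other point of the ball is the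
diameter of the ball. -/
def IsIsolatedSelection (p : Set Y → Y) : Prop :=
  ∀ A, IsUltrametricBall A → p A ∈ A ∧ ∀ w ∈ A, w ≠ p A → dist (p A) w = Metric.diam A

/-- The points that are not selected in any ball with at least two points. -/
def unselected (p : Set Y → Y) : Set Y :=
  {y | ∀ A, IsUltrametricBall A → A.Nontrivial → y ≠ p A}

variable {p : Set Y → Y} {A : Set Y}

/-- Let `s` be selected in `B`. If `B` were at least as large as `A`, it would contain `A`, and
isolation of `s` from `p A` would force the diameters, hence the balls, to be equal, giving `s = p
A`. -/
theorem IsIsolatedSelection.exists_ball_of_notMem [Finite Y] (hp : IsIsolatedSelection p) (hA : IsUltrametricBall A)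
    {s : Y} (hs : s ∈ A) (hsA : s ≠ p A) (hsu : s ∉ unselected p) :
    ∃ B, IsUltrametricBall B ∧ s = p B ∧ B.Nontrivial ∧ Metric.diam B < Metric.diam A := by
  simp only [unselected, Set.mem_ofPred_eq, not_forall, not_not] at hsu
  obtain ⟨B, hB, hn, rfl⟩ := hsu
  refine ⟨B, hB, rfl, hn, lt_of_not_ge fun hle => hsA ?_⟩
  have hpB := (hp B hB).1
  have hsub := hB.subset_of_mem hs hpB hle
  have hd := (hp B hB).2 (p A) (hsub (hp A hA).1) hsA.symm
  rw [← hB.eq_of_mem hA hpB hs (hle.antisymm' ?_)]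
  exact hd.symm.trans_le (dist_le_diam_of_finite hs (hp A hA).1)

variable [IsUltrametricDist Y]

theorem dist_eq_of_near {x y s t : Y} (hx : dist x s < dist s t) (hy : dist y t < dist s t) :
    dist x y = dist s t := by
  have h1 : dist x t = dist s t := dist_eq_of_dist_lt (dist_comm x s ▸ hx)
  rw [dist_comm s t, dist_comm x y, ← h1.trans (dist_comm s t), dist_comm x t]
  apply dist_eq_of_dist_lt
  rwa [dist_comm t y, dist_comm t x, h1]

/-- The smallest ball of the whole space that contains a given ball of a subspace. -/
noncomputable def Ballean.hull {Z : Set Y} (C : Ballean Z) : Set Y :=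
  Metric.closedBall C.nonempty_val.some.1 (Metric.diam C.1)

theorem Ballean.isUltrametricBall_hull {Z : Set Y} (C : Ballean Z) : IsUltrametricBall C.hull :=
  .closedBall Metric.diam_nonneg

variable [Finite Y]

theorem IsIteratedBalleanSpace.exists_isIsolatedSelection [Nonempty Y] {n : ℕ}
    (h : IsIteratedBalleanSpace (n + 1) Y) : ∃ p : Set Y → Y, IsIsolatedSelection p := by
  have : ∀ A : Set Y, ∃ q : Y, IsUltrametricBall A →
      q ∈ A ∧ ∀ w ∈ A, w ≠ q → dist q w = Metric.diam A := by
    intro A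
    by_cases hA : IsUltrametricBall A
    swap
    -- The value on sets that are not balls is irrelevant.
    · exact ⟨Classical.arbitrary Y, fun h => absurd h hA⟩
    by_cases hn : A.Nontrivial
    · obtain ⟨-, S, hS, hd⟩ := h.of_ball hA hn
      obtain ⟨s, hs⟩ := Finset.card_pos.1 (n.succ_pos.trans_le hS)
      exact ⟨s, fun _ => hd s hs⟩
    · obtain ⟨q, hq⟩ := hA.1
      exact ⟨q, fun _ => ⟨hq, fun w hw hne => absurd ⟨q, hq, w, hw, hne.symm⟩ hn⟩⟩
  exact ⟨fun A => (this A).choose, fun A => (this A).choose_spec⟩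

namespace IsIsolatedSelection

/-- If `s` itself was selected, then in a strictly smaller nontrivial ball `B`. Another point of `B`
has an unselected point near it by induction on the ball, and everything within `B` is closer than
`diam A`. -/
theorem exists_unselected_near (hp : IsIsolatedSelection p) (hA : IsUltrametricBall A)
    {s : Y} (hs : s ∈ A) (hsA : s ≠ p A) :
    ∃ x ∈ unselected p, dist x s < Metric.diam A := by
  induction A using WellFoundedLT.induction generalizing s with
  | ind A ih =>
    by_cases hsu : s ∈ unselected p
    · refine ⟨s, hsu, ?_⟩
      rw [dist_self]
      exact diam_pos_of_nontrivial ⟨s, hs, p A, (hp A hA).1, hsA⟩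
    · obtain ⟨B, hB, rfl, hn, hlt⟩ := hp.exists_ball_of_notMem hA hs hsA hsu
      have hpB := (hp B hB).1
      obtain ⟨w, hw, hne⟩ := hn.exists_ne (p B)
      have hss : B ⊂ A := (hA.subset_of_mem hpB hs hlt.le).ssubset_of_ne
        fun h => hlt.ne (congrArg _ h)
      obtain ⟨x, hx, hxw⟩ := ih B hss hB hw hne
      refine ⟨x, hx, (dist_triangle_max x w (p B)).trans_lt (max_lt (hxw.trans hlt) ?_)⟩
      exact (dist_le_diam_of_finite hw hpB).trans_lt hlt

/-- Of `n + 3` equidistant points at most one is `p A`. Replacing each of the others by a nearby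
unselected point does not change the mutual distances. -/
theorem exists_finset_unselected (hp : IsIsolatedSelection p) {n : ℕ}
    (h : IsIteratedBalleanSpace (n + 1) Y) (hA : IsUltrametricBall A) (hn : A.Nontrivial) :
    ∃ S : Finset (unselected p), n + 2 ≤ S.card ∧ (∀ s ∈ S, s.1 ∈ A) ∧
      ∀ s ∈ S, ∀ t ∈ S, s ≠ t → dist s t = Metric.diam A := by
  classical
  obtain ⟨⟨S, hS, hSA, hd⟩, -⟩ := h.of_ball hA hn
  have hnear : ∀ s : S.erase (p A), ∃ x : unselected p, dist x.1 s.1 < Metric.diam A := by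
    rintro ⟨s, hs⟩
    rw [Finset.mem_erase] at hs
    obtain ⟨x, hx, hd⟩ := hp.exists_unselected_near hA (hSA s hs.2) hs.1
    exact ⟨⟨x, hx⟩, hd⟩
  choose g hg using hnear
  have hgd : ∀ s t, s ≠ t → dist (g s) (g t) = Metric.diam A := by
    intro s t hst
    have hst' : dist s.1 t.1 = Metric.diam A := hd s (Finset.mem_of_mem_erase s.2) t
      (Finset.mem_of_mem_erase t.2) fun h => hst (Subtype.ext h)
    rw [← hst']
    exact dist_eq_of_near (hst' ▸ hg s) (hst' ▸ hg t)
  have hinj : Function.Injective g := by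
    intro s t hst
    by_contra hne
    have := hgd s t hne
    rw [hst, dist_self] at this
    exact (diam_pos_of_nontrivial hn).ne this
  refine ⟨Finset.univ.image g, ?_, ?_, ?_⟩
  · rw [Finset.card_image_of_injective _ hinj, Finset.card_univ, Fintype.card_coe]
    have := Finset.pred_card_le_card_erase (s := S) (a := p A)
    omega
  · simp only [Finset.mem_image, Finset.mem_univ, true_and, forall_exists_index,
      forall_apply_eq_imp_iff]
    exact fun s => hA.2 s (hSA s (Finset.mem_of_mem_erase s.2)) _
      (dist_comm s.1 (g s).1 ▸ (hg s).le)
  · simp only [Finset.mem_image, Finset.mem_univ, true_and, forall_exists_index,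
      forall_apply_eq_imp_iff]
    exact fun s t hst => hgd s t fun h => hst (congrArg g h)

theorem isIteratedBalleanSpace_unselected (hp : IsIsolatedSelection p) {n : ℕ}
    (h : IsIteratedBalleanSpace (n + 1) Y) : IsIteratedBalleanSpace n (unselected p) := by
  classical
  intro x y hxy
  let A := Metric.closedBall x.1 (dist x.1 y.1)
  have hA : IsUltrametricBall A := .closedBall dist_nonneg
  have hxA : x.1 ∈ A := Metric.mem_closedBall_self dist_nonneg
  have hn : A.Nontrivial :=
    ⟨x, hxA, y, Metric.mem_closedBall'.2 le_rfl, fun h => hxy (Subtype.ext h)⟩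
  have hd : Metric.diam A = dist x y := IsUltrametricBall.diam_closedBall_dist
  have hmem : ∀ z : unselected p, dist x z ≤ Metric.diam A ↔ z.1 ∈ A := fun z =>
    ⟨hA.2 x hxA z, fun hz => dist_le_diam_of_finite hxA hz⟩
  simp only [← hd, hmem]
  refine ⟨hp.exists_finset_unselected h hA hn, ?_⟩
  obtain ⟨-, S, hS, hSd⟩ := h.of_ball hA hn
  -- An isolated point of `A` other than `p A` cannot be selected in a smaller nontrivial ball: the
  -- other points of that ball would be too close to it.
  have hu : ∀ s ∈ S.erase (p A), s ∈ unselected p := by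
    intro s hs
    obtain ⟨hsA, hs⟩ := Finset.mem_erase.1 hs
    by_contra hsu
    obtain ⟨B, hB, rfl, hnB, hlt⟩ := hp.exists_ball_of_notMem hA (hSd s hs).1 hsA hsu
    have hpB := (hp B hB).1
    obtain ⟨w, hw, hne⟩ := hnB.exists_ne (p B)
    have := (hSd _ hs).2 w (hA.subset_of_mem hpB (hSd _ hs).1 hlt.le hw) hne
    exact (this.symm.trans_le (dist_le_diam_of_finite hpB hw)).not_gt hlt
  refine ⟨(S.erase (p A)).attach.image fun s => ⟨s.1, hu s.1 s.2⟩, ?_, ?_⟩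
  · rw [Finset.card_image_of_injective _ fun s t hst => Subtype.ext (congrArg (·.1) hst),
      Finset.card_attach]
    have := Finset.pred_card_le_card_erase (s := S) (a := p A)
    omega
  · intro s hs
    obtain ⟨t, -, rfl⟩ := Finset.mem_image.1 hs
    have := hSd t.1 (Finset.mem_of_mem_erase t.2)
    exact ⟨this.1, fun w hw hne => this.2 w.1 hw fun h => hne (Subtype.ext h)⟩

/-- Selected points obey the distance formula of `Ballean.dist_eq_of_diam_le`; the point to check is
that nested balls select different points. -/
theorem dist_eq (hp : IsIsolatedSelection p) {B : Set Y} (hA : IsUltrametricBall A)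
    (hB : IsUltrametricBall B) (hne : A ≠ B) (hle : Metric.diam A ≤ Metric.diam B) {a b : Y}
    (ha : a ∈ A) (hau : a ∈ unselected p) (hb : b ∈ B) :
    dist (p A) (p B) = max (Metric.diam B) (dist a b) := by
  obtain ⟨hpA, hdA⟩ := hp A hA
  obtain ⟨hpB, hdB⟩ := hp B hB
  rcases lt_or_ge (Metric.diam B) (dist a b) with h | h
  · rw [max_eq_right h.le]
    exact dist_eq_of_near ((dist_le_diam_of_finite hpA ha).trans_lt (hle.trans_lt h))
      ((dist_le_diam_of_finite hpB hb).trans_lt h)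
  · rw [max_eq_left h]
    have haB : a ∈ B := hB.2 b hb a (dist_comm a b ▸ h)
    have hsub := hB.subset_of_mem ha haB hle
    have hlt := hle.lt_of_ne fun h => hne (hA.eq_of_mem hB ha haB h)
    rw [dist_comm]
    refine hdB _ (hsub hpA) fun heq => ?_
    -- If `p A = p B`, a further point of `A` would be at distance both `diam A` and `diam B` from
    -- it. If `A` is a single point, that point is the unselected `a`, which differs from `p B`.
    by_cases hn : A.Nontrivial
    · obtain ⟨w, hw, hwA⟩ := hn.exists_ne (p A)
      refine hlt.ne ?_
      rw [← hdA w hw hwA, ← hdB w (hsub hw) (heq ▸ hwA), heq]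
    · obtain rfl := Set.not_nontrivial_iff.1 hn ha hpA
      exact hau B hB (nontrivial_of_diam_ne_zero (Metric.diam_nonneg.trans_lt hlt).ne') heq

end IsIsolatedSelection

namespace Ballean

variable {Z : Set Y} (C : Ballean Z)

theorem mem_hull {z : Z} : z.1 ∈ C.hull ↔ z ∈ C.1 := by
  have h := C.nonempty_val.some_mem
  rw [hull, Metric.mem_closedBall']
  exact ⟨C.isUltrametricBall.2 _ h z, fun hz => dist_le_diam_of_finite h hz⟩

theorem diam_hull : Metric.diam C.hull = Metric.diam C.1 := by
  obtain ⟨c, hc⟩ := C.nonempty_val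
  obtain ⟨z, hz, hd⟩ := exists_dist_eq_diam hc
  refine (IsUltrametricBall.diam_closedBall_le Metric.diam_nonneg).antisymm ?_
  exact hd.symm.trans_le (dist_le_diam_of_finite (C.mem_hull.2 hc) (C.mem_hull.2 hz))

theorem hull_injective : Function.Injective (hull : Ballean Z → Set Y) := by
  intro C D h
  refine Subtype.ext (Set.ext fun z => ?_)
  rw [← C.mem_hull, ← D.mem_hull, h]

end Ballean

theorem IsIsolatedSelection.isometry_hull (hp : IsIsolatedSelection p) :
    Isometry fun C : Ballean (unselected p) => p C.hull := by
  have key : ∀ C D : Ballean (unselected p), C ≠ D → Metric.diam C.1 ≤ Metric.diam D.1 →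
      dist (p C.hull) (p D.hull) = dist C D := by
    intro C D hne hle
    obtain ⟨c, hc⟩ := C.nonempty_val
    obtain ⟨d, hd⟩ := D.nonempty_val
    rw [Ballean.dist_eq_of_diam_le hne hc hd hle, hp.dist_eq C.isUltrametricBall_hull
      D.isUltrametricBall_hull (Ballean.hull_injective.ne hne) (by rwa [C.diam_hull, D.diam_hull])
      (C.mem_hull.2 hc) c.2 (D.mem_hull.2 hd), D.diam_hull]
    rfl
  refine Isometry.of_dist_eq fun C D => ?_
  by_cases hne : C = D
  · simp [hne]
  rcases le_total (Metric.diam C.1) (Metric.diam D.1) with h | h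
  · exact key C D hne h
  · rw [dist_comm, dist_comm C]
    exact key D C (Ne.symm hne) h

/-- An unselected point comes from its one-point ball. For `p A` with `A` nontrivial, `A` contains
two unselected points at distance `diam A`, so it is the hull of a ball of the subspace. -/
theorem IsIsolatedSelection.surjective_hull (hp : IsIsolatedSelection p) {n : ℕ}
    (h : IsIteratedBalleanSpace (n + 1) Y) :
    Function.Surjective fun C : Ballean (unselected p) => p C.hull := by
  intro y
  by_cases hy : y ∈ unselected p
  · refine ⟨.point ⟨y, hy⟩, dist_le_zero.1 ?_⟩
    have hb := (Ballean.point (⟨y, hy⟩ : unselected p)).isUltrametricBall_hull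
    refine (dist_le_diam_of_finite (hp _ hb).1 ((Ballean.mem_hull _).2 rfl)).trans ?_
    rw [Ballean.diam_hull]
    exact (Metric.diam_subsingleton Set.subsingleton_singleton).le
  · simp only [unselected, Set.mem_ofPred_eq, not_forall, not_not] at hy
    obtain ⟨A, hA, hn, rfl⟩ := hy
    obtain ⟨S, hS, hSA, hd⟩ := hp.exists_finset_unselected h hA hn
    obtain ⟨a, ha, b, hb, hab⟩ := Finset.one_lt_card.1 (show 1 < S.card by omega)
    refine ⟨.ofDist a b, congrArg p ?_⟩
    have hmem : a ∈ (Ballean.ofDist a b).1 := Metric.mem_closedBall_self dist_nonneg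
    refine (Ballean.isUltrametricBall_hull _).eq_of_mem hA ((Ballean.mem_hull _).2 hmem)
      (hSA a ha) ?_
    rw [Ballean.diam_hull, ← hd a ha b hb hab]
    exact IsUltrametricBall.diam_closedBall_dist

end Selection

theorem exists_isometryEquiv_ballean (Y : FinUltrametricSpace.{u}) {n : ℕ}
    (h : IsIteratedBalleanSpace (n + 1) Y.carrier) :
    ∃ X : FinUltrametricSpace.{u}, IsIteratedBalleanSpace n X.carrier ∧
      Nonempty (X.ballean.carrier ≃ᵢ Y.carrier) := by
  obtain ⟨p, hp⟩ := h.exists_isIsolatedSelection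
  have hne : Nonempty (unselected p) := by
    by_cases hn : (Set.univ : Set Y.carrier).Nontrivial
    · obtain ⟨S, hS, -⟩ := hp.exists_finset_unselected h isUltrametricBall_univ hn
      obtain ⟨s, -⟩ := Finset.card_pos.1 (show 0 < S.card by omega)
      exact ⟨s⟩
    · obtain ⟨y⟩ := Y.nonempty
      exact ⟨y, fun A _ hA => absurd (hA.mono (Set.subset_univ A)) hn⟩
  exact ⟨⟨unselected p⟩, hp.isIteratedBalleanSpace_unselected h,
    ⟨.mk (.ofBijective _ ⟨hp.isometry_hull.injective, hp.surjective_hull h⟩) hp.isometry_hull⟩⟩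

/-! ### Invariance under isometry -/

section Isometry

variable {X : Type u} {Y : Type v} [MetricSpace X] [MetricSpace Y]

/-- An isometry of spaces induces an isometry of their balleans. -/
noncomputable def Ballean.congr (e : X ≃ᵢ Y) : Ballean X ≃ᵢ Ballean Y where
  toFun B := ⟨e '' B.1, by
    obtain ⟨c, r, hr, h⟩ := B.2
    exact ⟨e c, r, hr, by rw [h, e.image_closedBall]⟩⟩
  invFun B := ⟨e.symm '' B.1, by
    obtain ⟨c, r, hr, h⟩ := B.2
    exact ⟨e.symm c, r, hr, by rw [h, e.symm.image_closedBall]⟩⟩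
  left_inv B := Subtype.ext (e.toEquiv.symm_image_image B.1)
  right_inv B := Subtype.ext (e.toEquiv.image_symm_image B.1)
  isometry_toFun := Isometry.of_dist_eq fun _ _ => Metric.hausdorffDist_image e.isometry

variable [Finite X] [Finite Y]

theorem IsNextLevel.image (e : X ≃ᵢ Y) {A B : Set X} (h : IsNextLevel A B) :
    IsNextLevel (e '' A) (e '' B) := by
  obtain ⟨hA, x, hx, rfl⟩ := isNextLevel_iff.1 h
  refine isNextLevel_iff.2 ⟨hA.image e.injective, e x, Set.mem_image_of_mem e hx, ?_⟩
  ext y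
  obtain ⟨y, rfl⟩ := e.surjective y
  simp [e.diam_image, e.dist_eq]

theorem isNextLevel_image_iff (e : X ≃ᵢ Y) {A B : Set X} :
    IsNextLevel (e '' A) (e '' B) ↔ IsNextLevel A B := by
  refine ⟨fun h => ?_, IsNextLevel.image e⟩
  have key : ∀ A : Set X, e.symm '' (e '' A) = A := e.toEquiv.symm_image_image
  simpa only [key] using h.image e.symm

theorem IsRepresentingVertex.image (e : X ≃ᵢ Y) {A : Set X} (h : IsRepresentingVertex X A) :
    IsRepresentingVertex Y (e '' A) := by
  induction h with
  | root =>
    rw [Set.image_univ_of_surjective e.surjective]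
    exact .root
  | next _ hB ih => exact ih.next (hB.image e)

theorem isomorphic_representingTree (e : X ≃ᵢ Y) :
    (representingTree X).Isomorphic (representingTree Y) := by
  let f : {A : Set X // IsRepresentingVertex X A} ≃ {A : Set Y // IsRepresentingVertex Y A} :=
    { toFun := fun A => ⟨e '' A.1, A.2.image e⟩
      invFun := fun A => ⟨e.symm '' A.1, A.2.image e.symm⟩
      left_inv := fun A => Subtype.ext (e.toEquiv.symm_image_image A.1)
      right_inv := fun A => Subtype.ext (e.toEquiv.image_symm_image A.1) }
  refine ⟨⟨f, fun {A B} => ?_⟩, ?_, fun A => ?_⟩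
  · exact and_congr f.injective.ne_iff
      (or_congr (isNextLevel_image_iff e) (isNextLevel_image_iff e))
  · exact Subtype.ext (Set.image_univ_of_surjective e.surjective)
  · exact NNReal.eq (e.diam_image A.1)

end Isometry

theorem exists_isometryEquiv_iteratedBallean (n : ℕ) (Y : FinUltrametricSpace.{u})
    (h : IsIteratedBalleanSpace n Y.carrier) :
    ∃ X : FinUltrametricSpace.{u}, Nonempty ((X.iteratedBallean n).carrier ≃ᵢ Y.carrier) := by
  induction n generalizing Y with
  | zero => exact ⟨Y, ⟨.refl _⟩⟩
  | succ n ih =>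
    obtain ⟨Z, hZ, ⟨e⟩⟩ := exists_isometryEquiv_ballean Y h
    obtain ⟨X, ⟨f⟩⟩ := ih Z hZ
    exact ⟨X, ⟨(Ballean.congr f).trans e⟩⟩

/-- Every finite nonempty ultrametric space is isometric to one in a prescribed universe. -/
theorem exists_finUltrametricSpace_isometryEquiv (X : FinUltrametricSpace.{u}) :
    ∃ Y : FinUltrametricSpace.{v}, Nonempty (Y.carrier ≃ᵢ X.carrier) := by
  obtain ⟨k, ⟨e⟩⟩ := Finite.exists_equiv_fin X.carrier
  let f : ULift.{v} (Fin k) ≃ X.carrier := Equiv.ulift.trans e.symm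
  let : MetricSpace (ULift.{v} (Fin k)) := MetricSpace.induced f f.injective inferInstance
  have hf : Isometry f := Isometry.of_dist_eq fun _ _ => rfl
  have : IsUltrametricDist (ULift.{v} (Fin k)) :=
    ⟨fun x y z => dist_triangle_max (f x) (f y) (f z)⟩
  have : Nonempty (ULift.{v} (Fin k)) := f.symm.nonempty_congr.1 X.nonempty
  exact ⟨⟨ULift.{v} (Fin k)⟩, ⟨.mk f hf⟩⟩

/-! ### Realising a tree by the space of its ends -/

namespace LabeledRootedGraph

variable {V : Type u} {T : LabeledRootedGraph V}

/-- `a` is `b` or a vertex above `b`. -/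
def IsAncestor (T : LabeledRootedGraph V) (a b : V) : Prop :=
  Relation.ReflTransGen (fun b a : V => b ∈ T.directSuccessors a) b a

/-- The vertices without direct successors. -/
def ends (T : LabeledRootedGraph V) : Set V :=
  {a | T.directSuccessors a = ∅}

theorem IsAncestor.refl (a : V) : T.IsAncestor a a := Relation.ReflTransGen.refl

theorem IsAncestor.trans {a b c : V} (h : T.IsAncestor a b) (h' : T.IsAncestor b c) :
    T.IsAncestor a c :=
  Relation.ReflTransGen.trans h' h

theorem IsAncestor.of_mem {a b : V} (h : b ∈ T.directSuccessors a) : T.IsAncestor a b :=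
  .single h

theorem IsAncestor.total (hT : T.IsTree) {a b x : V} (ha : T.IsAncestor a x)
    (hb : T.IsAncestor b x) : T.IsAncestor a b ∨ T.IsAncestor b a :=
  (Relation.ReflTransGen.total_of_right_unique (directSuccessors_rightUnique hT) ha hb).symm

theorem IsAncestor.exists_mem {a x : V} (h : T.IsAncestor a x) (hne : x ≠ a) :
    ∃ c ∈ T.directSuccessors a, T.IsAncestor c x := by
  obtain h | ⟨c, hc, hca⟩ := Relation.ReflTransGen.cases_tail h
  · exact absurd h.symm hne
  · exact ⟨c, hca, hc⟩

/-- Labels strictly decrease along the direct successors. -/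
def IsDecreasing (T : LabeledRootedGraph V) : Prop :=
  ∀ x y : V, y ∈ T.directSuccessors x → T.label y < T.label x

theorem IsAncestor.eq_or_lt (hl : T.IsDecreasing) {a b : V} (h : T.IsAncestor a b) :
    b = a ∨ T.label b < T.label a := by
  induction h with
  | refl => exact .inl rfl
  | tail _ h ih =>
    obtain rfl | ih := ih
    · exact .inr (hl _ _ h)
    · exact .inr (ih.trans (hl _ _ h))

theorem IsAncestor.label_le (hl : T.IsDecreasing) {a b : V} (h : T.IsAncestor a b) :
    T.label b ≤ T.label a := by
  obtain rfl | h := h.eq_or_lt hl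
  · exact le_rfl
  · exact h.le

theorem IsAncestor.of_label_le (hT : T.IsTree) (hl : T.IsDecreasing) {a b x : V}
    (ha : T.IsAncestor a x) (hb : T.IsAncestor b x) (h : T.label a ≤ T.label b) :
    T.IsAncestor b a := by
  refine (ha.total hT hb).elim (fun h' => ?_) id
  obtain rfl | h' := h'.eq_or_lt hl
  · exact .refl _
  · exact absurd h h'.not_ge

theorem IsAncestor.eq_of_label_eq (hT : T.IsTree) (hl : T.IsDecreasing) {a b x : V}
    (ha : T.IsAncestor a x) (hb : T.IsAncestor b x) (h : T.label a = T.label b) : a = b :=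
  ((ha.of_label_le hT hl hb h.le).eq_or_lt hl).resolve_right h.not_lt

/-- The vertices `c` and `t`, both above `x`, are comparable. If `t` were strictly above `c`, it
would be `a` or above `a`, with too large a label. -/
theorem IsAncestor.of_label_lt (hT : T.IsTree) (hl : T.IsDecreasing) {a c t x : V}
    (hc : c ∈ T.directSuccessors a) (hx : T.IsAncestor c x) (ht : T.IsAncestor t x)
    (h : T.label t < T.label a) : T.IsAncestor c t := by
  refine (hx.total hT ht).elim id fun h' => ?_
  obtain rfl | ⟨d, hd, h'⟩ := Relation.ReflTransGen.cases_head h'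
  · exact .refl _
  · obtain rfl := directSuccessors_rightUnique hT hd hc
    exact absurd h (IsAncestor.label_le hl h').not_gt

theorem exists_end [Finite V] (hl : T.IsDecreasing) (a : V) :
    ∃ x : T.ends, T.IsAncestor a x := by
  obtain ⟨b, hb, hmin⟩ := Set.exists_min_image {b | T.IsAncestor a b} T.label (Set.toFinite _)
    ⟨a, .refl a⟩
  refine ⟨⟨b, Set.eq_empty_iff_forall_notMem.2 fun c hc => ?_⟩, hb⟩
  exact (hmin c (hb.trans (.of_mem hc))).not_gt (hl _ _ hc)

theorem isAncestor_root (hT : T.IsTree) (a : V) : T.IsAncestor T.root a :=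
  reflTransGen_root hT a

/-- The least label of a common ancestor. -/
noncomputable def meetLabel (T : LabeledRootedGraph V) (x y : V) : ℝ :=
  ⨅ a : {a : V // T.IsAncestor a x ∧ T.IsAncestor a y}, (T.label a : ℝ)

theorem meetLabel_comm (x y : V) : T.meetLabel x y = T.meetLabel y x :=
  (Equiv.subtypeEquivRight fun _ => and_comm).iInf_congr fun _ => rfl

theorem meetLabel_le [Finite V] {a x y : V} (hx : T.IsAncestor a x) (hy : T.IsAncestor a y) :
    T.meetLabel x y ≤ T.label a :=
  ciInf_le (Set.finite_range _).bddBelow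
    (⟨a, hx, hy⟩ : {a : V // T.IsAncestor a x ∧ T.IsAncestor a y})

theorem exists_meetLabel_eq [Finite V] (hT : T.IsTree) (x y : V) :
    ∃ a, T.IsAncestor a x ∧ T.IsAncestor a y ∧ T.label a = T.meetLabel x y := by
  have : Nonempty {a : V // T.IsAncestor a x ∧ T.IsAncestor a y} :=
    ⟨⟨T.root, isAncestor_root hT x, isAncestor_root hT y⟩⟩
  obtain ⟨a, ha⟩ := exists_eq_ciInf_of_finite
    (f := fun a : {a : V // T.IsAncestor a x ∧ T.IsAncestor a y} => (T.label a : ℝ))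
  exact ⟨a, a.2.1, a.2.2, ha⟩

/-- The two minimal common ancestors both lie above `y`, so they are comparable, and the upper one
is a common ancestor of `x` and `z`. -/
theorem meetLabel_triangle_max [Finite V] (hT : T.IsTree) (hl : T.IsDecreasing) (x y z : V) :
    T.meetLabel x z ≤ max (T.meetLabel x y) (T.meetLabel y z) := by
  obtain ⟨a, hax, hay, ha⟩ := exists_meetLabel_eq hT x y
  obtain ⟨b, hby, hbz, hb⟩ := exists_meetLabel_eq hT y z
  rw [← ha, ← hb]
  rcases le_total (T.label a) (T.label b) with h | h
  · exact le_max_of_le_right (meetLabel_le ((hay.of_label_le hT hl hby h).trans hax) hbz)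
  · exact le_max_of_le_left (meetLabel_le hax ((hby.of_label_le hT hl hay h).trans hbz))

theorem mem_ends_iff [Finite V] (h0 : ∀ x : V, T.outDegree x = 0 ↔ T.label x = 0) {a : V} :
    a ∈ T.ends ↔ T.label a = 0 :=
  outDegree_eq_zero_iff.symm.trans (h0 a)

theorem IsAncestor.eq_of_mem_ends {a x : V} (h : T.IsAncestor a x) (ha : a ∈ T.ends) : x = a := by
  by_contra hne
  obtain ⟨c, hc, -⟩ := h.exists_mem hne
  exact (Set.eq_empty_iff_forall_notMem.1 ha c) hc

/-- The vertices without direct successors, with the least label of a common ancestor as the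
distance. -/
noncomputable abbrev endsMetricSpace [Finite V] (hT : T.IsTree) (hl : T.IsDecreasing)
    (h0 : ∀ x : V, T.outDegree x = 0 ↔ T.label x = 0) : MetricSpace T.ends :=
  have hnonneg : ∀ x y : V, 0 ≤ T.meetLabel x y := fun x y =>
    Real.iInf_nonneg fun a => (T.label a).2
  { dist := fun x y => T.meetLabel x y
    dist_self := fun x => by
      refine le_antisymm ?_ (hnonneg _ _)
      refine (meetLabel_le (.refl x.1) (.refl x.1)).trans_eq ?_
      rw [(mem_ends_iff h0).1 x.2, NNReal.coe_zero]
    dist_comm := fun x y => meetLabel_comm _ _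
    dist_triangle := fun x y z => (meetLabel_triangle_max hT hl x y z).trans
      (max_le_add_of_nonneg (hnonneg _ _) (hnonneg _ _))
    eq_of_dist_eq_zero := fun {x y} h => by
      obtain ⟨a, hx, hy, ha⟩ := exists_meetLabel_eq hT x.1 y.1
      have ha' : a ∈ T.ends := (mem_ends_iff h0).2 (NNReal.coe_eq_zero.1 (ha.trans h))
      exact Subtype.ext ((hx.eq_of_mem_ends ha').trans (hy.eq_of_mem_ends ha').symm) }

/-- The vertices without direct successors that lie below `a`. -/
def endsBelow (T : LabeledRootedGraph V) (a : V) : Set T.ends :=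
  {x | T.IsAncestor a x}

section EndsBelow

variable [Finite V] [MetricSpace T.ends]

/-- Take ends below two different direct successors of `a`. A common ancestor with a smaller label
than `a` would lie below both of these, which would make them comparable and hence equal. -/
theorem exists_pair_dist_eq (hT : T.IsTree) (hl : T.IsDecreasing)
    (h1 : ∀ x : V, T.outDegree x ≠ 1) (hd : ∀ x y : T.ends, dist x y = T.meetLabel x y)
    {a : V} (ha : a ∉ T.ends) :
    ∃ x ∈ T.endsBelow a, ∃ y ∈ T.endsBelow a, dist x y = T.label a := by
  have hcard : 1 < (T.directSuccessors a).ncard := by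
    have h0 : T.outDegree a ≠ 0 := fun h => ha (outDegree_eq_zero_iff.1 h)
    have := h1 a
    change 1 < T.outDegree a
    omega
  obtain ⟨b, c, hb, hc, hbc⟩ := (Set.one_lt_ncard_iff (Set.toFinite _)).1 hcard
  obtain ⟨x, hx⟩ := exists_end hl b
  obtain ⟨y, hy⟩ := exists_end hl c
  have hax := (IsAncestor.of_mem hb).trans hx
  have hay := (IsAncestor.of_mem hc).trans hy
  refine ⟨x, hax, y, hay, ?_⟩
  rw [hd]
  refine (meetLabel_le hax hay).eq_of_not_lt fun hlt => hbc ?_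
  obtain ⟨t, htx, hty, ht⟩ := exists_meetLabel_eq hT x.1 y.1
  rw [← ht, NNReal.coe_lt_coe] at hlt
  have hbt := IsAncestor.of_label_lt hT hl hb hx htx hlt
  have hct := IsAncestor.of_label_lt hT hl hc hy hty hlt
  exact ((IsAncestor.of_label_lt hT hl hb hbt hct (hl _ _ hc)).eq_or_lt hl).elim Eq.symm
    fun h => ((IsAncestor.of_label_lt hT hl hc hct hbt (hl _ _ hb)).eq_or_lt hl).elim id
      fun h' => absurd h h'.not_gt

theorem diam_endsBelow (hT : T.IsTree) (hl : T.IsDecreasing)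
    (h0 : ∀ x : V, T.outDegree x = 0 ↔ T.label x = 0)
    (h1 : ∀ x : V, T.outDegree x ≠ 1) (hd : ∀ x y : T.ends, dist x y = T.meetLabel x y) (a : V) :
    Metric.diam (T.endsBelow a) = T.label a := by
  apply le_antisymm
  · refine Metric.diam_le_of_forall_dist_le (T.label a).2 fun x hx y hy => ?_
    rw [hd]
    exact meetLabel_le hx hy
  · by_cases ha : a ∈ T.ends
    · rw [(mem_ends_iff h0).1 ha]
      exact Metric.diam_nonneg
    · obtain ⟨x, hx, y, hy, h⟩ := exists_pair_dist_eq hT hl h1 hd ha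
      exact h.symm.trans_le (dist_le_diam_of_finite hx hy)

theorem isNextLevel_endsBelow (hT : T.IsTree) (hl : T.IsDecreasing)
    (h0 : ∀ x : V, T.outDegree x = 0 ↔ T.label x = 0)
    (h1 : ∀ x : V, T.outDegree x ≠ 1) (hd : ∀ x y : T.ends, dist x y = T.meetLabel x y) {a b : V}
    (h : b ∈ T.directSuccessors a) : IsNextLevel (T.endsBelow a) (T.endsBelow b) := by
  have hdiam := diam_endsBelow hT hl h0 h1 hd a
  obtain ⟨x, hx⟩ := exists_end hl b
  have hab := IsAncestor.of_mem h
  refine isNextLevel_iff.2 ⟨?_, x, hab.trans hx, ?_⟩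
  · refine nontrivial_of_diam_ne_zero ?_
    rw [hdiam, Ne, NNReal.coe_eq_zero, ← mem_ends_iff h0]
    exact fun ha => (Set.eq_empty_iff_forall_notMem.1 ha b) h
  · ext y
    constructor
    · intro hy
      refine ⟨hab.trans hy, ?_⟩
      rw [hd, hdiam]
      exact (meetLabel_le hx hy).trans_lt (NNReal.coe_lt_coe.2 (hl _ _ h))
    · rintro ⟨-, hlt⟩
      rw [hd, hdiam] at hlt
      obtain ⟨t, htx, hty, ht⟩ := exists_meetLabel_eq hT x.1 y.1
      rw [← ht, NNReal.coe_lt_coe] at hlt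
      exact (IsAncestor.of_label_lt hT hl h hx htx hlt).trans hty

/-- The isomorphism is `T.endsBelow`. It is injective because the diameter recovers the label, and
vertices above a common end with equal labels coincide; it is onto because every part of
`T.endsBelow a` is the set of ends below a direct successor of `a`. -/
theorem isomorphic_representingTree_ends [IsUltrametricDist T.ends] (hT : T.IsTree)
    (hl : T.IsDecreasing) (h0 : ∀ x : V, T.outDegree x = 0 ↔ T.label x = 0)
    (h1 : ∀ x : V, T.outDegree x ≠ 1) (hd : ∀ x y : T.ends, dist x y = T.meetLabel x y) :
    T.Isomorphic (representingTree T.ends) := by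
  have hdiam := diam_endsBelow hT hl h0 h1 hd
  have hnext : ∀ {a b : V}, b ∈ T.directSuccessors a →
      IsNextLevel (T.endsBelow a) (T.endsBelow b) := isNextLevel_endsBelow hT hl h0 h1 hd
  have hroot : T.endsBelow T.root = Set.univ :=
    Set.eq_univ_of_forall fun x => isAncestor_root hT x.1
  have hinj : Function.Injective T.endsBelow := by
    intro a b hab
    obtain ⟨x, hx⟩ := exists_end hl a
    have hxb : x ∈ T.endsBelow b := hab ▸ hx
    refine IsAncestor.eq_of_label_eq hT hl hx hxb (NNReal.coe_injective ?_)
    rw [← hdiam, ← hdiam, hab]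
  have hchild : ∀ {a : V} {B : Set T.ends}, IsNextLevel (T.endsBelow a) B →
      ∃ c ∈ T.directSuccessors a, T.endsBelow c = B := by
    intro a B h
    obtain ⟨x, hx⟩ := h.nonempty
    have hax : T.IsAncestor a x := h.subset hx
    obtain ⟨c, hc, hcx⟩ := hax.exists_mem (by
      rintro rfl
      refine (diam_pos_of_nontrivial h.1).ne' ?_
      rw [hdiam, (mem_ends_iff h0).1 x.2, NNReal.coe_zero])
    exact ⟨c, hc, (hnext hc).eq_of_common h hcx hx⟩
  have hvert : ∀ a, IsRepresentingVertex T.ends (T.endsBelow a) := by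
    intro a
    induction reflTransGen_root hT a using Relation.ReflTransGen.head_induction_on with
    | refl =>
      rw [hroot]
      exact .root
    | head h _ ih => exact ih.next (hnext h)
  have hsurj : ∀ A, IsRepresentingVertex T.ends A → ∃ a, T.endsBelow a = A := by
    intro A hA
    induction hA with
    | root => exact ⟨T.root, hroot⟩
    | next _ hB ih =>
      obtain ⟨a, rfl⟩ := ih
      obtain ⟨c, -, hc⟩ := hchild hB
      exact ⟨c, hc⟩
  have hiff : ∀ {a b : V}, IsNextLevel (T.endsBelow a) (T.endsBelow b) ↔
      b ∈ T.directSuccessors a := by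
    refine fun {a b} => ⟨fun h => ?_, hnext⟩
    obtain ⟨c, hc, hcb⟩ := hchild h
    rwa [← hinj hcb]
  let f : V ≃ {A : Set T.ends // IsRepresentingVertex T.ends A} :=
    Equiv.ofBijective (fun a => ⟨T.endsBelow a, hvert a⟩)
      ⟨fun a b h => hinj (congrArg Subtype.val h),
        fun A => (hsurj A.1 A.2).imp fun _ h => Subtype.ext h⟩
  refine ⟨⟨f, fun {a b} => ?_⟩, Subtype.ext hroot, fun a => NNReal.eq (hdiam a)⟩
  rw [adj_iff_mem_directSuccessors hT, ← hiff, ← hiff]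
  refine ⟨fun h => h.2, fun h => ⟨?_, h⟩⟩
  intro he
  have he' : T.endsBelow a = T.endsBelow b := congrArg Subtype.val he
  rw [he', or_self] at h
  exact h.diam_lt.ne rfl

end EndsBelow

theorem IsIteratedBalleanTree.exists_isomorphic [Finite V] {n : ℕ}
    (h : T.IsIteratedBalleanTree n) (hT : T.IsTree) :
    ∃ X : FinUltrametricSpace.{u}, T.Isomorphic (representingTree X.carrier) := by
  obtain ⟨h1, h0, hl, -⟩ := h
  let := endsMetricSpace hT hl h0
  have : IsUltrametricDist T.ends := ⟨fun x y z => meetLabel_triangle_max hT hl x.1 y.1 z.1⟩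
  have : Nonempty T.ends := (exists_end hl T.root).nonempty
  exact ⟨⟨T.ends⟩, isomorphic_representingTree_ends hT hl h0
    (fun x hx => h1 x (by simp [hx])) fun _ _ => rfl⟩

end LabeledRootedGraph

theorem mainTheorem3 {V : Type u} [Finite V] (T : LabeledRootedGraph V) (hT : T.IsTree) (n : ℕ) :
    (∃ X : FinUltrametricSpace.{v},
        T.Isomorphic (representingTree (X.iteratedBallean n).carrier)) ↔
      (∀ x : V, T.outDegree x ∉ Set.Icc 1 (n + 1)) ∧
      (∀ x : V, T.outDegree x = 0 ↔ T.label x = 0) ∧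
      (∀ x y : V, y ∈ T.directSuccessors x → T.label y < T.label x) ∧
      (∀ x : V, x ∉ T.leaves → n ≤ (T.directSuccessors x ∩ T.leaves).ncard) := by
  change _ ↔ T.IsIteratedBalleanTree n
  constructor
  · rintro ⟨X, h⟩
    exact h.symm.isIteratedBalleanTree (isIteratedBalleanTree_representingTree (h.isTree hT)
      (isIteratedBalleanSpace_iteratedBallean X n))
  · intro h
    obtain ⟨Z, hZ⟩ := h.exists_isomorphic hT
    -- The space of ends lives in the universe of `V`, while `X` is sought in universe `v`.
    obtain ⟨Y, ⟨e⟩⟩ := exists_finUltrametricSpace_isometryEquiv.{u, v} Z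
    have hY := hZ.trans (isomorphic_representingTree e.symm)
    obtain ⟨X, ⟨f⟩⟩ := exists_isometryEquiv_iteratedBallean n Y
      (isIteratedBalleanSpace_of_representingTree (hY.isTree hT) (hY.isIteratedBalleanTree h))
    exact ⟨X, hY.trans (isomorphic_representingTree f.symm)⟩
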